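/- A weighted recursive game graph (WRG) $\mathcal A=\langle A_1,\dots,A_n\rangle$ consists of modules $A_i$ with pairwise disjoint finite sets of nodes $N_i$ and boxes $B_i$, nonempty sets $\mathit{En}_i,\mathit{Ex}_i\subseteq N_i$ of entry and exit nodes, a map $Y_i:B_i\to\{1,\dots,n\}$ giving the module invoked by each box, a partition of $N_i\cup B_i$ into player-1 and player-2 vertices, a transition relation $\delta_i\subseteq (N_i\cup \mathrm{Retns}_i)\times(N_i\cup\mathrm{Calls}_i)$, where $\mathrm{Calls}_i=\{(b,e): b\in B_i, e\in \mathit{En}_{Y_i(b)}\}$ and $\mathrm{Retns}_i=\{(b,x): b\in B_i, x\in \mathit{Ex}_{Y_i(b)}\}$, and an integer weight for every transition. A configuration is a sequence $(b_1,\dots,b_r,u)$ of boxes $b_j$ and a node $u$. If $u$ is not an exit, the play is at the place $u$, with context $(b_1,\dots,b_r)$. If $u$ is an exit and $r>0$, it is at the return place $(b_r,u)$, with context $(b_1,\dots,b_{r-1})$, and the owner of the box $b_r$ chooses. The owner of the place chooses a transition that leaves it: if the target is a node $v$, the next configuration is the context followed by $v$; if the target is a call $(b,e)$, it is the context followed by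 $b$ and $e$. No move is possible at an exit with empty stack. A play is an infinite sequence of configurations obtained in this way. The local history of a finite play is the sequence of places (non-exit nodes and returns) visited during the current invocation of the current module: take the longest suffix in which the length of the context is never smaller than it is at the end, and keep the places whose context has this length. A modular strategy of player 1 is a family $\tau=\{\tau_i\}_{i=1}^n$ of functions, where $\tau_i$ maps every finite sequence of places of $A_i$ that ends in a player-1 place to a transition of $\delta_i$ leaving that place. A play is consistent with $\tau$ if at every player-1 place, of module $A_i$ say, the transition taken is $\tau_i$ of the local history. For a play $\pi$ let $w(\pi[1,k])$ be the sum of the weights of its first $k$ transitions, and put $\mathrm{LimInfAvg}(\pi)=\liminf_{k\to\infty} w(\pi[1,k])/k$ and $\mathrm{LimSupAvg}(\pi)=\limsup_{k\to\infty} w(\pi[1,k])/k$. Given a set $C_0$ of initial configurations (for example, a single entry node with empty stack), $\tau$ is winning for an objective if every play that starts in $C_0$ and is consistent with $\tau$ satisfies the objective. Statement. For every WRG $\mathcal A$ and every set $C_0$ of initial configurations, there exists a modular winning strategy for the objective $\mathrm{LimSupAvg}\ge 0$ if and only if there exists a modular winning strategy for the objective $\mathrm{LimInfAvg}\ge 0$.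 -/

import Mathlib

open Filter

/-- The places of a recursive game graph from which a transition can leave: nodes `u`, and
returns `(b, x)`, where `b` is a box and `x` an exit of the module that `b` invokes. -/
inductive Place (N B : Type*) where
  | node (u : N) : Place N B
  | ret (b : B) (x : N) : Place N B

/-- The possible targets of a transition: nodes `v`, and calls `(b, e)`, where `b` is a box and
`e` an entry of the module that `b` invokes. -/
inductive Target (N B : Type*) where
  | node (v : N) : Target N B
  | call (b : B) (e : N) : Target N B

/-- The module in which a place lies (a return `(b, x)` lies in the module of the box `b`). -/
def Place.moduleOf {N B I : Type*} (nodeModule : N → I) (boxModule : B → I) : Place N B → I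
  | .node u => nodeModule u
  | .ret b _ => boxModule b

/-- The module in which a target lies (a call `(b, e)` lies in the module of the box `b`). -/
def Target.moduleOf {N B I : Type*} (nodeModule : N → I) (boxModule : B → I) : Target N B → I
  | .node v => nodeModule v
  | .call b _ => boxModule b

/-- A weighted recursive game graph with modules `A_i`, `i : Fin n`. `N` and `B` are the (disjoint)
unions of the sets of nodes and of boxes of the modules, so that
`N_i = {u | nodeModule u = i}` and `B_i = {b | boxModule b = i}`. -/
structure WRG (n : ℕ) (N B : Type*) where
  nodeModule : N → Fin n
  boxModule : B → Fin n
  /-- the index of the module that a box invokes -/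
  label : B → Fin n
  /-- the entry nodes -/
  En : Set N
  /-- the exit nodes -/
  Ex : Set N
  En_nonempty : ∀ i, ∃ e ∈ En, nodeModule e = i
  Ex_nonempty : ∀ i, ∃ x ∈ Ex, nodeModule x = i
  /-- the nodes and boxes under the control of player 1; the others are under the control of
  player 2 -/
  V1 : Set (N ⊕ B)
  /-- the union of the transition relations of the modules -/
  trans : Set (Place N B × Target N B)
  trans_module : ∀ p t, (p, t) ∈ trans →
    p.moduleOf nodeModule boxModule = t.moduleOf nodeModule boxModule
  trans_ret : ∀ b x t, (Place.ret b x, t) ∈ trans → x ∈ Ex ∧ nodeModule x = label b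
  trans_call : ∀ p b e, (p, Target.call b e) ∈ trans → e ∈ En ∧ nodeModule e = label b
  /-- the weight of a transition (only the values on `trans` matter) -/
  weight : Place N B → Target N B → ℤ

/-- A configuration `(b_1, …, b_r, u)`; the head of the list `stack` is the topmost box `b_r`. -/
structure Config (N B : Type*) where
  stack : List B
  node : N

namespace WRG

variable {n : ℕ} {N B : Type*} (A : WRG n N B)

/-- The module of a place. -/
def placeModule (p : Place N B) : Fin n := p.moduleOf A.nodeModule A.boxModule

/-- The places at which a choice is made: the nodes that are not exits (an exit only returns to the
calling module), and the returns `(b, x)`, `x` an exit of the module invoked by `b`. -/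
def IsChoicePlace : Place N B → Prop
  | .node u => u ∉ A.Ex
  | .ret b x => x ∈ A.Ex ∧ A.nodeModule x = A.label b

/-- The places at which player 1 chooses; a return `(b, x)` belongs to the owner of the box `b`. -/
def IsPlayer1 : Place N B → Prop
  | .node u => Sum.inl u ∈ A.V1
  | .ret b _ => Sum.inr b ∈ A.V1

open Classical in
/-- The place from which the play continues at a configuration: in `(b_1, …, b_r, x)` with `x` an
exit and `r > 0` it is the return `(b_r, x)`, otherwise it is the current node. -/
noncomputable def place (c : Config N B) : Place N B :=
  if c.node ∈ A.Ex then
    match c.stack with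
    | [] => .node c.node
    | b :: _ => .ret b c.node
  else .node c.node

open Classical in
/-- The stack below the place `A.place c`: the box on top of the stack is removed if the current
node is an exit. -/
noncomputable def context (c : Config N B) : List B :=
  if c.node ∈ A.Ex then c.stack.tail else c.stack

/-- The stack height of the place of `c`. -/
noncomputable def height (c : Config N B) : ℕ := (A.context c).length

/-- The configuration reached from `c` by a transition with target `t`: a call pushes the box and
moves to the entry node. -/
noncomputable def next (c : Config N B) : Target N B → Config N B
  | .node v => ⟨A.context c, v⟩
  | .call b e => ⟨b :: A.context c, e⟩

/-- `A.CanMove c t`: there is a transition with target `t` that can be taken at `c`. There is none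
at an exit node with empty stack, since its place is not a choice place. -/
def CanMove (c : Config N B) (t : Target N B) : Prop :=
  A.IsChoicePlace (A.place c) ∧ (A.place c, t) ∈ A.trans

/-- The local history of a finite sequence of configurations whose last element is `c`: the
sequence of the places visited during the current invocation of the current module. It is obtained
from the longest suffix that never goes below the height of `c`, by keeping the places whose height
is that of `c`. -/
noncomputable def localHistory (ρ : List (Config N B)) (c : Config N B) : List (Place N B) :=
  ((((ρ ++ [c]).reverse.takeWhile (fun c' => A.height c ≤ A.height c')).filter
    (fun c' => A.height c' = A.height c)).map A.place).reverse

/-- A modular strategy of player 1: one local strategy for each module, which assigns to every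
nonempty sequence of places of the module that ends in a player-1 place a transition of the module
leaving that place (given by its target). Other arguments are irrelevant. -/
structure ModularStrategy where
  toFun : Fin n → List (Place N B) → Target N B
  legal : ∀ (i : Fin n) (h : List (Place N B)) (p : Place N B),
    (∀ q ∈ h ++ [p], A.IsChoicePlace q ∧ A.placeModule q = i) → A.IsPlayer1 p →
    (p, toFun i (h ++ [p])) ∈ A.trans

/-- An infinite play (a valid infinite sequence of configurations, recorded together with the
targets of the transitions taken). -/
structure Play where
  conf : ℕ → Config N B
  move : ℕ → Target N B
  canMove : ∀ k, A.CanMove (conf k) (move k)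
  conf_succ : ∀ k, conf (k + 1) = A.next (conf k) (move k)

variable {A}

/-- The local history of the prefix `c_0, …, c_k` of a play. -/
noncomputable def Play.localHistory (π : A.Play) (k : ℕ) : List (Place N B) :=
  A.localHistory ((List.range k).map π.conf) (π.conf k)

/-- A play is consistent with a modular strategy if all choices at player-1 places are those of the
local strategy of the current module, applied to the local history. -/
def Play.Consistent (π : A.Play) (τ : A.ModularStrategy) : Prop :=
  ∀ k, A.IsPlayer1 (A.place (π.conf k)) →
    π.move k = τ.toFun (A.placeModule (A.place (π.conf k))) (π.localHistory k)

/-- The average weight of the first `k` transitions of a play. -/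
noncomputable def Play.avg (π : A.Play) (k : ℕ) : ℝ :=
  ((∑ j ∈ Finset.range k, A.weight (A.place (π.conf j)) (π.move j) : ℤ) : ℝ) / (k : ℝ)

noncomputable def Play.limInfAvg (π : A.Play) : EReal :=
  liminf (fun k => ((π.avg k : ℝ) : EReal)) atTop

noncomputable def Play.limSupAvg (π : A.Play) : EReal :=
  limsup (fun k => ((π.avg k : ℝ) : EReal)) atTop

/-- `τ` is winning for the objective `LimInfAvg ≥ 0` for plays that start in `C₀`. -/
def ModularStrategy.WinsLimInf (τ : A.ModularStrategy) (C₀ : Set (Config N B)) : Prop :=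
  ∀ π : A.Play, π.conf 0 ∈ C₀ → π.Consistent τ → 0 ≤ π.limInfAvg

/-- `τ` is winning for the objective `LimSupAvg ≥ 0` for plays that start in `C₀`. -/
def ModularStrategy.WinsLimSup (τ : A.ModularStrategy) (C₀ : Set (Config N B)) : Prop :=
  ∀ π : A.Play, π.conf 0 ∈ C₀ → π.Consistent τ → 0 ≤ π.limSupAvg

end WRG

/-! Since the liminf never exceeds the limsup, only one direction needs work. Let `τ` win for the
limsup. For a place p that starts an invocation, consider the weights of the `τ`-consistent
invocations from p to a given exit, and of those that have just made a call with a given entry. A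
summary replaces each such set by one of its elements: the infimum if the set is bounded below, a
very negative element otherwise.

With calls replaced by summaries, one invocation becomes a finite game in which player 1 must close
only nonnegative cycles, and must exit or call with a weight not below the corresponding infimum for
`τ`. She wins it from every place at which `τ` lets an invocation start (`win_localGame`). Otherwise
player 2, playing against `τ` and deleting each closed cycle, closes negative cycles forever;
summary edges are realised by runs of bounded length, so the limsup is negative. In the same way the
graph of calls has no reachable negative cycle (`win_callGame`).

The improved strategy wins every local game, with the cycle-free position as memory; it is modular
because this memory depends on the local history alone. The totals of the memories on the stack form
a potential, bounded below by means of the call graph. In each transition it grows by at most the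
weight, except in returns whose exit weights under `τ` are unbounded below, where the real weight
may be worse than the summary.

These exceptions stop to matter. A summary below the threshold is too negative to lie on a
nonnegative cycle, so this heavy edge is never deleted. An invocation with a heavy edge can only
exit or call where the weights for `τ` are unbounded below, which creates a heavy edge for the
caller or in the call graph. A bounded rank counts these edges; from a suitable moment on no
exception occurs (`Change.exists_le_sum`), the sums of weights are bounded below, and the liminf is
nonnegative. -/

/-! ### First-cycle games and positions with cycles removed. -/

/-- A two-player game played until a vertex is repeated. A position is a list of vertices with the
weights of the edges leading to them, the current vertex first. -/
structure CycleGame (V T : Type*) where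
  P1 : V → Prop
  Leg : V → T → Prop
  /-- the possible successors of a vertex after a move, with the weights of the edges -/
  Out : V → T → V → ℤ → Prop
  /-- the condition under which the first player does not lose immediately -/
  Ok : List (V × ℤ) → T → Prop

namespace CycleGame

variable {V T : Type*}

/-- The total weight of a position. -/
def total (r : List (V × ℤ)) : ℤ := (r.map Prod.snd).sum

/-- The vertex `v` occurs in the position `r`. -/
def Mem (v : V) (r : List (V × ℤ)) : Prop := v ∈ r.map Prod.fst

open Classical in
/-- The part of a position up to the last visit of `v`. -/
noncomputable def cut (v : V) (r : List (V × ℤ)) : List (V × ℤ) :=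
  r.dropWhile (fun y => y.1 ≠ v)

open Classical in
/-- The part of a position after the last visit of `v`. -/
noncomputable def loop (v : V) (r : List (V × ℤ)) : List (V × ℤ) :=
  r.takeWhile (fun y => y.1 ≠ v)

theorem loop_append_cut (v : V) (r : List (V × ℤ)) : loop v r ++ cut v r = r :=
  List.takeWhile_append_dropWhile

theorem total_append (r s : List (V × ℤ)) : total (r ++ s) = total r + total s := by
  simp [total]

theorem total_cons (y : V × ℤ) (r : List (V × ℤ)) : total (y :: r) = y.2 + total r := by
  simp [total]

theorem total_loop_add_cut (v : V) (r : List (V × ℤ)) :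
    total (loop v r) + total (cut v r) = total r := by
  rw [← total_append, loop_append_cut]

theorem cut_eq_cons {v : V} {r : List (V × ℤ)} (h : Mem v r) :
    ∃ a s, cut v r = (v, a) :: s := by
  induction r with
  | nil => simp [Mem] at h
  | cons y r ih =>
    by_cases hy : y.1 = v
    · exact ⟨y.2, r, by simp [cut, ← hy]⟩
    · have : Mem v r := by
        simp only [Mem, List.map_cons, List.mem_cons] at h
        exact h.resolve_left (fun h => hy h.symm)
      obtain ⟨a, s, h⟩ := ih this
      exact ⟨a, s, by simpa [cut, List.dropWhile_cons, hy] using h⟩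

open Classical in
/-- The position after moving to `v` along an edge of weight `w`, where a cycle that is closed by
this move is removed. -/
noncomputable def extend (r : List (V × ℤ)) (v : V) (w : ℤ) : List (V × ℤ) :=
  if Mem v r then cut v r else (v, w) :: r

theorem extend_of_mem {r : List (V × ℤ)} {v : V} (h : Mem v r) (w : ℤ) :
    extend r v w = cut v r := if_pos h

theorem extend_of_not_mem {r : List (V × ℤ)} {v : V} (h : ¬ Mem v r) (w : ℤ) :
    extend r v w = (v, w) :: r := if_neg h

theorem extend_eq_cons (r : List (V × ℤ)) (v : V) (w : ℤ) :
    ∃ a s, extend r v w = (v, a) :: s := by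
  by_cases h : Mem v r
  · rw [extend_of_mem h]; exact cut_eq_cons h
  · exact ⟨w, r, extend_of_not_mem h w⟩

theorem cut_suffix (v : V) (r : List (V × ℤ)) : cut v r <:+ r := List.dropWhile_suffix _

theorem nodup_extend {r : List (V × ℤ)} (hr : (r.map Prod.fst).Nodup) (v : V) (w : ℤ) :
    ((extend r v w).map Prod.fst).Nodup := by
  by_cases h : Mem v r
  · rw [extend_of_mem h]
    exact hr.sublist ((cut_suffix v r).sublist.map _)
  · rw [extend_of_not_mem h]
    exact List.nodup_cons.2 ⟨h, hr⟩

theorem forall_mem_extend {r : List (V × ℤ)} {P : ℤ → Prop} (hr : ∀ y ∈ r, P y.2) (v : V) {w : ℤ}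
    (hw : P w) : ∀ y ∈ extend r v w, P y.2 := by
  by_cases h : Mem v r
  · rw [extend_of_mem h]
    exact fun y hy => hr y ((cut_suffix v r).subset hy)
  · rw [extend_of_not_mem h]
    intro y hy
    rcases List.mem_cons.1 hy with rfl | hy
    · exact hw
    · exact hr y hy

theorem getLast?_extend {r : List (V × ℤ)} (hr : r ≠ []) (v : V) (w : ℤ) :
    (extend r v w).getLast? = r.getLast? := by
  by_cases h : Mem v r
  · rw [extend_of_mem h]
    obtain ⟨a, s, hs⟩ := cut_eq_cons h
    conv_rhs => rw [← loop_append_cut v r]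
    rw [hs, List.getLast?_append]
    simp [List.getLast?_cons]
  · rw [extend_of_not_mem h]
    obtain ⟨y, s, rfl⟩ := List.exists_cons_of_ne_nil hr
    simp

theorem length_le_card [Finite V] {r : List (V × ℤ)} (hr : (r.map Prod.fst).Nodup) :
    r.length ≤ Nat.card V := by
  have := Fintype.ofFinite V
  rw [Nat.card_eq_fintype_card]
  simpa using hr.length_le_card

theorem total_le {r : List (V × ℤ)} {b : ℤ} (hb : 0 ≤ b) (hr : ∀ y ∈ r, y.2 ≤ b) {c : ℕ}
    (hc : r.length ≤ c) : total r ≤ c * b := by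
  have : total r ≤ r.length * b := by
    clear hc
    induction r with
    | nil => simp [total]
    | cons y r ih =>
      have h1 := hr y (by simp)
      have h2 := ih (fun z hz => hr z (by simp [hz]))
      rw [total_cons]
      push_cast [List.length_cons]
      linarith
  have h2 : (r.length : ℤ) * b ≤ c * b := by gcongr
  exact this.trans h2

theorem le_total {r : List (V × ℤ)} {b : ℤ} (hb : 0 ≤ b) (hr : ∀ y ∈ r, -b ≤ y.2) {c : ℕ}
    (hc : r.length ≤ c) : -(c * b) ≤ total r := by
  have : -(r.length * b) ≤ total r := by
    clear hc
    induction r with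
    | nil => simp [total]
    | cons y r ih =>
      have h1 := hr y (by simp)
      have h2 := ih (fun z hz => hr z (by simp [hz]))
      rw [total_cons]
      push_cast [List.length_cons]
      linarith
  have h2 : (r.length : ℤ) * b ≤ c * b := by gcongr
  linarith

/-- The number of edges of weight at most `-K`. -/
noncomputable def heavy (K : ℤ) (r : List (V × ℤ)) : ℕ :=
  r.countP (fun y => decide (y.2 ≤ -K))

theorem heavy_append (K : ℤ) (r s : List (V × ℤ)) :
    heavy K (r ++ s) = heavy K r + heavy K s := List.countP_append

theorem total_le_of_heavy {K b : ℤ} {r : List (V × ℤ)} (hb : 0 ≤ b)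
    (hr : ∀ y ∈ r, y.2 ≤ b) {c : ℕ} (hc : r.length ≤ c) (h : 0 < heavy K r) :
    total r ≤ c * b - K := by
  induction r generalizing c with
  | nil => simp [heavy] at h
  | cons y r ih =>
    obtain ⟨c, rfl⟩ : ∃ d, c = d + 1 := ⟨c - 1, by simp at hc; omega⟩
    have hc' : r.length ≤ c := by simpa using hc
    have hr' : ∀ z ∈ r, z.2 ≤ b := fun z hz => hr z (by simp [hz])
    have h1 := hr y (by simp)
    rw [total_cons]
    push_cast
    by_cases hy : y.2 ≤ -K
    · have := total_le hb hr' hc'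
      linarith
    · have : 0 < heavy K r := by simpa [heavy, List.countP_cons, hy] using h
      have := ih hr' hc' this
      linarith

/-- A cycle has at most `c + 1` edges of weight at most `b`, so by `hK` one heavy edge makes it
negative. Removing nonnegative cycles therefore never removes a heavy edge. -/
theorem heavy_extend {K b : ℤ} {r : List (V × ℤ)} {c : ℕ} (hb : 0 ≤ b)
    (hK : (c + 1) * b < K) (hr : ∀ y ∈ r, y.2 ≤ b) (hc : r.length ≤ c) {v : V} {w : ℤ}
    (hw : w ≤ b) (hl : Mem v r → 0 ≤ w + total (loop v r)) :
    heavy K r ≤ heavy K (extend r v w) ∧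
      (w ≤ -K → heavy K r + 1 ≤ heavy K (extend r v w)) := by
  have hcb : 0 ≤ (c : ℤ) * b := by positivity
  by_cases h : Mem v r
  · have hl := hl h
    rw [extend_of_mem h]
    have hsub : ∀ y ∈ loop v r, y.2 ≤ b := fun y hy => hr y ((List.takeWhile_prefix _).subset hy)
    have hlen : (loop v r).length ≤ c := ((List.takeWhile_prefix _).length_le).trans hc
    have h0 : heavy K (loop v r) = 0 := by
      by_contra h0
      have := total_le_of_heavy hb hsub hlen (Nat.pos_of_ne_zero h0)
      linarith
    constructor
    · conv_lhs => rw [← loop_append_cut v r]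
      rw [heavy_append, h0, zero_add]
    · intro hw'
      have := total_le hb hsub hlen
      linarith
  · rw [extend_of_not_mem h]
    simp only [heavy, List.countP_cons]
    refine ⟨Nat.le_add_right _ _, fun hwK => ?_⟩
    simp [hwK]

/-- A potential that decreases along the edges of a position when all closed cycles are negative. -/
def potential (N : ℕ) (r : List (V × ℤ)) : ℤ := N * total r + r.length

/-- A new vertex gains 1 through the length. A removed negative cycle gains at least `c + 1` through
the total, which pays for the at most `c` vertices lost. -/
theorem potential_extend {c : ℕ} {r : List (V × ℤ)} (hc : r.length ≤ c) {v : V} {w : ℤ}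
    (hl : Mem v r → w + total (loop v r) < 0) :
    (c + 1 : ℕ) * w ≤ potential (c + 1) (extend r v w) - potential (c + 1) r - 1 := by
  by_cases h : Mem v r
  · have hl := hl h
    rw [extend_of_mem h]
    have h1 := total_loop_add_cut v r
    have h2 : ((cut v r).length : ℤ) ≥ 0 := by positivity
    have h3 : (r.length : ℤ) ≤ c := by exact_mod_cast hc
    simp only [potential, ← h1]
    have h4 : ((c + 1 : ℕ) : ℤ) * (w + total (loop v r)) ≤ ((c + 1 : ℕ) : ℤ) * (-1) := by
      gcongr; omega
    push_cast at h4 ⊢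
    linarith
  · rw [extend_of_not_mem h]
    simp only [potential, total_cons, List.length_cons]
    push_cast
    linarith

theorem total_add_le_total_extend {r : List (V × ℤ)} {v : V} {w : ℤ}
    (hl : Mem v r → w + total (loop v r) < 0) : total r + w ≤ total (extend r v w) := by
  by_cases h : Mem v r
  · have hl := hl h
    rw [extend_of_mem h]
    have h1 := total_loop_add_cut v r
    linarith
  · rw [extend_of_not_mem h, total_cons]
    simp [add_comm]

theorem total_extend_le {r : List (V × ℤ)} {v : V} {w : ℤ}
    (hl : Mem v r → 0 ≤ w + total (loop v r)) : total (extend r v w) ≤ total r + w := by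
  by_cases h : Mem v r
  · have hl := hl h
    rw [extend_of_mem h]
    have h1 := total_loop_add_cut v r
    linarith
  · rw [extend_of_not_mem h, total_cons]
    simp [add_comm]

variable (G : CycleGame V T)

/-- The positions from which the first player wins. -/
inductive Win : List (V × ℤ) → Prop
  | first {q : V} {a : ℤ} {r : List (V × ℤ)} {t : T} : G.P1 q → G.Leg q t → G.Ok ((q, a) :: r) t →
      (∀ v w, G.Out q t v w → Mem v ((q, a) :: r) → 0 ≤ w + total (loop v ((q, a) :: r))) →
      (∀ v w, G.Out q t v w → ¬ Mem v ((q, a) :: r) → Win ((v, w) :: (q, a) :: r)) →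
      Win ((q, a) :: r)
  | second {q : V} {a : ℤ} {r : List (V × ℤ)} : ¬ G.P1 q →
      (∀ t, G.Leg q t → G.Ok ((q, a) :: r) t) →
      (∀ t, G.Leg q t → ∀ v w, G.Out q t v w → Mem v ((q, a) :: r) →
        0 ≤ w + total (loop v ((q, a) :: r))) →
      (∀ t, G.Leg q t → ∀ v w, G.Out q t v w → ¬ Mem v ((q, a) :: r) →
        Win ((v, w) :: (q, a) :: r)) →
      Win ((q, a) :: r)

/-- The move `t` from `q`, the current vertex of the position `r`, is winning. -/
def Good (r : List (V × ℤ)) (q : V) (t : T) : Prop :=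
  G.Ok r t ∧ ∀ v w, G.Out q t v w →
    (Mem v r → 0 ≤ w + total (loop v r)) ∧ (¬ Mem v r → G.Win ((v, w) :: r))

/-- Negating this one-step unfolding gives player 2 a reply at every position that is not won, so no
determinacy theorem is needed. -/
theorem win_iff {q : V} {a : ℤ} {r : List (V × ℤ)} : G.Win ((q, a) :: r) ↔
    (G.P1 q → ∃ t, G.Leg q t ∧ G.Good ((q, a) :: r) q t) ∧
      (¬ G.P1 q → ∀ t, G.Leg q t → G.Good ((q, a) :: r) q t) := by
  constructor
  · intro h
    cases h with
    | first h1 h2 h3 h4 h5 =>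
      exact ⟨fun _ => ⟨_, h2, h3, fun v w ho => ⟨h4 v w ho, h5 v w ho⟩⟩, fun h => absurd h1 h⟩
    | second h1 h2 h3 h4 =>
      exact ⟨fun h => absurd h h1, fun _ t ht => ⟨h2 t ht, fun v w ho =>
        ⟨h3 t ht v w ho, h4 t ht v w ho⟩⟩⟩
  · rintro ⟨h1, h2⟩
    by_cases h : G.P1 q
    · obtain ⟨t, ht, hg⟩ := h1 h
      exact .first h ht hg.1 (fun v w ho => (hg.2 v w ho).1) (fun v w ho => (hg.2 v w ho).2)
    · exact .second h (fun t ht => (h2 h t ht).1) (fun t ht v w ho => ((h2 h t ht).2 v w ho).1)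
        (fun t ht v w ho => ((h2 h t ht).2 v w ho).2)

/-- All nonempty initial parts of a position satisfy `P`. -/
def Along (P : List (V × ℤ) → Prop) (r : List (V × ℤ)) : Prop :=
  ∀ s, s <:+ r → s ≠ [] → P s

theorem Along.extend {P : List (V × ℤ) → Prop} {r : List (V × ℤ)} (h : Along P r) {v : V} {w : ℤ}
    (hv : ¬ Mem v r → P ((v, w) :: r)) : Along P (extend r v w) := by
  intro s hs hs'
  by_cases hm : Mem v r
  · rw [extend_of_mem hm] at hs
    exact h s (hs.trans (cut_suffix v r)) hs'
  · rw [extend_of_not_mem hm, List.suffix_cons_iff] at hs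
    rcases hs with rfl | hs
    · exact hv hm
    · exact h s hs hs'

theorem along_singleton {P : List (V × ℤ) → Prop} {y : V × ℤ} (h : P [y]) : Along P [y] := by
  intro s hs hs'
  rw [List.suffix_cons_iff] at hs
  rcases hs with rfl | hs
  · exact h
  · exact absurd (List.suffix_nil.1 hs) hs'

theorem Along.self {P : List (V × ℤ) → Prop} {r : List (V × ℤ)} (h : Along P r) (hr : r ≠ []) :
    P r := h r (List.suffix_refl r) hr

/-- All initial parts of the position are kept unwon, so that the position is still unwon after a
cycle has been cut off. -/
theorem exists_of_not_good {q : V} {a : ℤ} {r : List (V × ℤ)} {t : T}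
    (hs : Along (fun r => ¬ G.Win r) ((q, a) :: r)) (hg : ¬ G.Good ((q, a) :: r) q t)
    (hok : G.Ok ((q, a) :: r) t) :
    ∃ v w, G.Out q t v w ∧ Along (fun r => ¬ G.Win r) (extend ((q, a) :: r) v w) ∧
      (Mem v ((q, a) :: r) → w + total (loop v ((q, a) :: r)) < 0) := by
  simp only [Good, not_and, not_forall] at hg
  obtain ⟨v, w, ho, hvw⟩ := hg hok
  refine ⟨v, w, ho, hs.extend fun hm hw => (hvw fun h => absurd h hm).elim fun _ h => h hw,
    fun hm => ?_⟩
  by_contra hneg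
  exact (hvw fun _ => not_lt.1 hneg).elim fun h _ => h hm

/-- A move that the second player can answer when the first player does not win. -/
theorem exists_not_good {q : V} {a : ℤ} {r : List (V × ℤ)}
    (hs : ¬ G.Win ((q, a) :: r)) :
    (G.P1 q ∧ ∀ t, G.Leg q t → ¬ G.Good ((q, a) :: r) q t) ∨
      (¬ G.P1 q ∧ ∃ t, G.Leg q t ∧ ¬ G.Good ((q, a) :: r) q t) := by
  rw [win_iff] at hs
  by_cases h : G.P1 q
  · exact .inl ⟨h, fun t ht hg => hs ⟨fun _ => ⟨t, ht, hg⟩, fun h' => absurd h h'⟩⟩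
  · refine .inr ⟨h, ?_⟩
    by_contra hc
    push Not at hc
    exact hs ⟨fun h' => absurd h' h, fun _ => hc⟩

open Classical in
/-- A winning move of the first player, if there is one. -/
noncomputable def choice [Nonempty T] (r : List (V × ℤ)) (q : V) : T :=
  if h : ∃ t, G.Leg q t ∧ G.Good r q t then h.choose else Classical.arbitrary T

theorem choice_spec [Nonempty T] {r : List (V × ℤ)} {q : V}
    (h : ∃ t, G.Leg q t ∧ G.Good r q t) :
    G.Leg q (G.choice r q) ∧ G.Good r q (G.choice r q) := by
  rw [choice, dif_pos h]
  exact h.choose_spec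

/-- The moves that are compatible with the choices of the first player. -/
def Adm [Nonempty T] (r : List (V × ℤ)) (q : V) (t : T) : Prop :=
  G.Leg q t ∧ (G.P1 q → t = G.choice r q)

theorem Adm.good [Nonempty T] {q : V} {a : ℤ} {r : List (V × ℤ)} {t : T}
    (h : G.Adm ((q, a) :: r) q t) (hw : G.Win ((q, a) :: r)) : G.Good ((q, a) :: r) q t := by
  rw [win_iff] at hw
  by_cases hq : G.P1 q
  · rw [h.2 hq]
    exact (G.choice_spec (hw.1 hq)).2
  · exact hw.2 hq t h.1

/-- The smallest weight of an edge to `v` after a move that is compatible with the choices of the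
first player. -/
noncomputable def edge [Nonempty T] (r : List (V × ℤ)) (q v : V) : ℤ :=
  sInf {w | ∃ t, G.Adm r q t ∧ G.Out q t v w}

/-- The memory update of the first player. -/
noncomputable def update [Nonempty T] (r : List (V × ℤ)) (q v : V) : List (V × ℤ) :=
  extend r v (G.edge r q v)

/-- The memory sees only the vertices visited, not the moves between them, so it records the least
weight that explains a step; the lower bound `-b` makes this least weight attained. -/
theorem edge_spec [Nonempty T] {b : ℤ} (hb : ∀ q t v w, G.Out q t v w → -b ≤ w)
    {r : List (V × ℤ)} {q v : V} {t : T} {w : ℤ} (ha : G.Adm r q t) (ho : G.Out q t v w) :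
    G.edge r q v ≤ w ∧ ∃ t, G.Adm r q t ∧ G.Out q t v (G.edge r q v) := by
  have hbdd : BddBelow {w | ∃ t, G.Adm r q t ∧ G.Out q t v w} :=
    ⟨-b, by rintro w ⟨t, _, h⟩; exact hb _ _ _ _ h⟩
  have hne : {w | ∃ t, G.Adm r q t ∧ G.Out q t v w}.Nonempty := ⟨w, t, ha, ho⟩
  exact ⟨csInf_le hbdd ⟨t, ha, ho⟩, Int.csInf_mem hne hbdd⟩

/-- What a position of the first player satisfies when she follows her choices. -/
structure Safe (b b' : ℤ) (r : List (V × ℤ)) : Prop where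
  along : Along G.Win r
  nodup : (r.map Prod.fst).Nodup
  le : ∀ y ∈ r, y.2 ≤ b
  ge : ∀ y ∈ r, -b' ≤ y.2

theorem safe_singleton {b b' : ℤ} (hb : 0 ≤ b) (hb' : 0 ≤ b') {v : V} (h : G.Win [(v, 0)]) :
    G.Safe b b' [(v, 0)] :=
  ⟨along_singleton h, by simp, by simpa using hb, by simpa using hb'⟩

/-- The recorded edge is itself admissible, so winning applies to it, and it is no heavier than the
real one. Hence the total gains at most the real weight, and a really heavy edge is recorded as
heavy. -/
theorem Safe.update [Finite V] [Nonempty T] {b b' K : ℤ} (hb : 0 ≤ b)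
    (hup : ∀ q t v w, G.Out q t v w → w ≤ b) (hlow : ∀ q t v w, G.Out q t v w → -b' ≤ w)
    (hK : (Nat.card V + 1) * b < K) {q : V} {a : ℤ} {r : List (V × ℤ)}
    (hs : G.Safe b b' ((q, a) :: r)) {t : T} (ha : G.Adm ((q, a) :: r) q t) {v : V} {w : ℤ}
    (ho : G.Out q t v w) :
    G.Safe b b' (G.update ((q, a) :: r) q v) ∧
      total (G.update ((q, a) :: r) q v) ≤ total ((q, a) :: r) + w ∧
      heavy K ((q, a) :: r) ≤ heavy K (G.update ((q, a) :: r) q v) ∧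
      (w ≤ -K → heavy K ((q, a) :: r) + 1 ≤ heavy K (G.update ((q, a) :: r) q v)) := by
  obtain ⟨hle, t', ha', ho'⟩ := G.edge_spec hlow ha ho
  have hg := ha'.good G (hs.along.self (by simp))
  obtain ⟨h1, h2⟩ := hg.2 _ _ ho'
  have hh := heavy_extend hb hK hs.le (length_le_card hs.nodup) (hup _ _ _ _ ho') h1
  refine ⟨⟨hs.along.extend h2, nodup_extend hs.nodup _ _,
    forall_mem_extend (P := fun x => x ≤ b) hs.le _ (hup _ _ _ _ ho'),
    forall_mem_extend (P := fun x => -b' ≤ x) hs.ge _ (hlow _ _ _ _ ho')⟩, ?_, hh.1, fun hw => hh.2 (hle.trans hw)⟩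
  have := total_extend_le h1
  exact this.trans (by linarith)

end CycleGame

/-! ### Plays as sequences of states that carry the local histories. -/

instance {N B : Type*} [Finite N] [Finite B] : Finite (Place N B) := by
  refine Finite.of_injective
    (fun p : Place N B => (match p with | .node u => .inl u | .ret b x => .inr (b, x) :
      N ⊕ (B × N))) ?_
  rintro (u | ⟨b, x⟩) (v | ⟨b', x'⟩) h <;> simp_all

instance {N B : Type*} [Finite N] [Finite B] : Finite (Target N B) := by
  refine Finite.of_injective
    (fun p : Target N B => (match p with | .node u => .inl u | .call b x => .inr (b, x) :
      N ⊕ (B × N))) ?_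
  rintro (u | ⟨b, x⟩) (v | ⟨b', x'⟩) h <;> simp_all

/-- A stack of boxes, each with the local history of the invocation that is suspended there. All
histories are listed with the most recent place first. -/
abbrev Frames (N B : Type*) := List (B × List (Place N B))

/-- The local history of the current invocation and the stack of suspended invocations. -/
structure HState (N B : Type*) where
  hist : List (Place N B)
  stk : Frames N B

namespace WRG

variable {n : ℕ} {N B : Type*} (A : WRG n N B)

open Classical in
/-- The effect of a transition on a state. -/
noncomputable def step : HState N B → Target N B → HState N B
  | ⟨h, stk⟩, .node v =>
    if v ∈ A.Ex then
      match stk with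
      | [] => ⟨.node v :: h, []⟩
      | (b, h') :: stk' => ⟨.ret b v :: h', stk'⟩
    else ⟨.node v :: h, stk⟩
  | ⟨h, stk⟩, .call b e =>
    if e ∈ A.Ex then ⟨.ret b e :: h, stk⟩ else ⟨[.node e], (b, h) :: stk⟩

/-- The state at the beginning of a play. -/
noncomputable def initState (c : Config N B) : HState N B :=
  ⟨[A.place c], (A.context c).map (fun b => (b, []))⟩

/-- The states of the play from `c` with the given moves. -/
noncomputable def states (c : Config N B) (move : ℕ → Target N B) : ℕ → HState N B
  | 0 => A.initState c
  | k + 1 => A.step (states c move k) (move k)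

/-- The configurations of the play from `c` with the given moves. -/
noncomputable def confs (c : Config N B) (move : ℕ → Target N B) : ℕ → Config N B
  | 0 => c
  | k + 1 => A.next (confs c move k) (move k)

variable {A}

theorem step_node {v : N} (hv : v ∉ A.Ex) (h : List (Place N B)) (stk : Frames N B) :
    A.step ⟨h, stk⟩ (.node v) = ⟨.node v :: h, stk⟩ := if_neg hv

theorem step_exit {x : N} (hx : x ∈ A.Ex) (h : List (Place N B)) (b : B)
    (h' : List (Place N B)) (stk : Frames N B) :
    A.step ⟨h, (b, h') :: stk⟩ (.node x) = ⟨.ret b x :: h', stk⟩ := if_pos hx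

theorem step_exit_nil {x : N} (hx : x ∈ A.Ex) (h : List (Place N B)) :
    A.step ⟨h, []⟩ (.node x) = ⟨.node x :: h, []⟩ := if_pos hx

theorem step_call_exit {b : B} {e : N} (he : e ∈ A.Ex) (h : List (Place N B))
    (stk : Frames N B) : A.step ⟨h, stk⟩ (.call b e) = ⟨.ret b e :: h, stk⟩ := if_pos he

theorem step_call {b : B} {e : N} (he : e ∉ A.Ex) (h : List (Place N B))
    (stk : Frames N B) : A.step ⟨h, stk⟩ (.call b e) = ⟨[.node e], (b, h) :: stk⟩ := if_neg he

variable (A)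

/-- The places at height `m` visited since the height was last below `m`, in a list of
configurations with the most recent one first. -/
noncomputable def localPlaces (l : List (Config N B)) (m : ℕ) : List (Place N B) :=
  ((l.takeWhile (fun c => m ≤ A.height c)).filter (fun c => A.height c = m)).map A.place

theorem localPlaces_cons_eq {c : Config N B} {m : ℕ} (h : A.height c = m)
    (l : List (Config N B)) : A.localPlaces (c :: l) m = A.place c :: A.localPlaces l m := by
  simp [localPlaces, h]

theorem localPlaces_cons_lt {c : Config N B} {m : ℕ} (h : m < A.height c)
    (l : List (Config N B)) : A.localPlaces (c :: l) m = A.localPlaces l m := by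
  simp [localPlaces, h.le, h.ne']

theorem localPlaces_cons_gt {c : Config N B} {m : ℕ} (h : A.height c < m)
    (l : List (Config N B)) : A.localPlaces (c :: l) m = [] := by
  simp [localPlaces, h]

/-- The state `s` describes the play with the configurations `c :: l`, most recent first. -/
structure Describes (c : Config N B) (l : List (Config N B)) (s : HState N B) : Prop where
  head : s.hist.head? = some (A.place c)
  context : A.context c = s.stk.map Prod.fst
  hist : A.localPlaces (c :: l) s.stk.length = s.hist
  frames : ∀ b h suf, (b, h) :: suf <:+ s.stk → A.localPlaces (c :: l) suf.length = h

variable {A}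

theorem Describes.height {c : Config N B} {l : List (Config N B)} {s : HState N B}
    (h : A.Describes c l s) : A.height c = s.stk.length := by
  rw [WRG.height, h.context, List.length_map]

/-- The boxes of the initial stack carry empty histories, because a local history records only
places visited during the play. -/
theorem describes_initState (c : Config N B) : A.Describes c [] (A.initState c) := by
  refine ⟨rfl, ?_, ?_, ?_⟩
  · simp [initState, Function.comp_def]
  · rw [A.localPlaces_cons_eq (by simp [initState, WRG.height])]
    simp [localPlaces, initState]
  · intro b h suf hs
    have hlen := hs.length_le
    have hmem : (b, h) ∈ (A.initState c).stk := hs.subset (by simp)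
    rw [A.localPlaces_cons_lt (by simpa [initState, WRG.height] using hlen)]
    simp only [initState, List.mem_map, Prod.mk.injEq] at hmem
    obtain ⟨_, _, _, rfl⟩ := hmem
    simp [localPlaces]

theorem Describes.push {c c' : Config N B} {l : List (Config N B)} {h : List (Place N B)}
    {stk : Frames N B} (hd : A.Describes c l ⟨h, stk⟩) {p : Place N B} (hp : A.place c' = p)
    (hc : A.context c' = stk.map Prod.fst) : A.Describes c' (c :: l) ⟨p :: h, stk⟩ := by
  have hh : A.height c' = stk.length := by rw [WRG.height, hc, List.length_map]
  refine ⟨by simp [hp], hc, ?_, ?_⟩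
  · rw [A.localPlaces_cons_eq hh, hd.hist, hp]
  · intro b h' suf hs
    have := hs.length_le
    rw [A.localPlaces_cons_lt (by rw [hh]; simpa using this)]
    exact hd.frames b h' suf hs

/-- Configurations higher than `m` do not affect `localPlaces _ m`, so a suspended history survives
the call and is current again after the return. A call starts afresh, since the height was just
lower. -/
theorem Describes.step {c : Config N B} {l : List (Config N B)} {s : HState N B}
    (hd : A.Describes c l s) (t : Target N B) :
    A.Describes (A.next c t) (c :: l) (A.step s t) := by
  obtain ⟨h, stk⟩ := s
  have hctx : A.context c = stk.map Prod.fst := hd.context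
  have hheight : A.height c = stk.length := hd.height
  cases t with
  | node v =>
    by_cases hv : v ∈ A.Ex
    · cases stk with
      | nil =>
        rw [step_exit_nil hv]
        have hctx : A.context c = [] := hctx
        exact hd.push (by simp [WRG.place, WRG.next, hv, hctx])
          (by rw [WRG.context, if_pos (show (A.next c (.node v)).node ∈ A.Ex from hv)]
              exact congrArg List.tail hctx)
      | cons f stk =>
        obtain ⟨b, h'⟩ := f
        rw [step_exit hv]
        have hctx : A.context c = b :: stk.map Prod.fst := hctx
        have hc : A.context (A.next c (.node v)) = stk.map Prod.fst := by
          rw [WRG.context, if_pos (show (A.next c (.node v)).node ∈ A.Ex from hv)]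
          show (A.context c).tail = _
          rw [hctx]; rfl
        have hp : A.place (A.next c (.node v)) = .ret b v := by
          rw [WRG.place, if_pos (show (A.next c (.node v)).node ∈ A.Ex from hv)]
          show (match A.context c with | [] => _ | b :: _ => _) = _
          rw [hctx]; rfl
        have hh : A.height (A.next c (.node v)) = stk.length := by
          rw [WRG.height, hc, List.length_map]
        refine ⟨by simp [hp], hc, ?_, ?_⟩
        · rw [A.localPlaces_cons_eq hh, hp]
          exact congrArg _ (hd.frames b h' stk (List.suffix_refl _))
        · intro b' h'' suf hs
          have := hs.length_le
          rw [A.localPlaces_cons_lt (by rw [hh]; simpa using this)]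
          exact hd.frames b' h'' suf (hs.trans (List.suffix_cons _ _))
    · rw [step_node hv]
      exact hd.push (by rw [WRG.place, if_neg (show (A.next c (.node v)).node ∉ A.Ex from hv)]; rfl)
        (by rw [WRG.context, if_neg (show (A.next c (.node v)).node ∉ A.Ex from hv)]; exact hctx)
  | call b e =>
    by_cases he : e ∈ A.Ex
    · rw [step_call_exit he]
      exact hd.push
        (by rw [WRG.place, if_pos (show (A.next c (.call b e)).node ∈ A.Ex from he)]; rfl)
        (by rw [WRG.context, if_pos (show (A.next c (.call b e)).node ∈ A.Ex from he)]
            exact hctx)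
    · rw [step_call he]
      have hp : A.place (A.next c (.call b e)) = .node e := by
        rw [WRG.place, if_neg (show (A.next c (.call b e)).node ∉ A.Ex from he)]; rfl
      have hc : A.context (A.next c (.call b e)) = b :: stk.map Prod.fst := by
        rw [WRG.context, if_neg (show (A.next c (.call b e)).node ∉ A.Ex from he), ← hctx]; rfl
      have hh : A.height (A.next c (.call b e)) = stk.length + 1 := by
        rw [WRG.height, hc]; simp
      refine ⟨by simp [hp], hc, ?_, ?_⟩
      · rw [A.localPlaces_cons_eq (by rw [hh]; rfl), hp,
          A.localPlaces_cons_gt (by rw [hheight]; simp)]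
      · intro b' h' suf hs
        have hl : suf.length ≤ stk.length := by simpa using hs.length_le
        rw [A.localPlaces_cons_lt (by rw [hh]; omega)]
        rcases List.suffix_cons_iff.1 hs with heq | hs
        · obtain ⟨h1, rfl⟩ := List.cons.inj heq
          obtain ⟨rfl, rfl⟩ := Prod.mk.inj h1
          exact hd.hist
        · exact hd.frames b' h' suf hs

theorem Describes.localHistory {c : Config N B} {ρ : List (Config N B)} {s : HState N B}
    (h : A.Describes c ρ.reverse s) : A.localHistory ρ c = s.hist.reverse := by
  have := h.hist
  rw [← h.height] at this
  rw [← this, WRG.localHistory, localPlaces, List.reverse_append]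
  rfl

theorem describes_states (c : Config N B) (move : ℕ → Target N B) (k : ℕ) :
    A.Describes (A.confs c move k) ((List.range k).map (A.confs c move)).reverse
      (A.states c move k) := by
  induction k with
  | zero => exact describes_initState c
  | succ k ih =>
    have := ih.step (move k)
    rwa [show A.confs c move k :: ((List.range k).map (A.confs c move)).reverse =
      ((List.range (k + 1)).map (A.confs c move)).reverse by simp [List.range_succ]] at this

variable (A)

/-- The weight of a transition after a history. -/
def histWeight : List (Place N B) → Target N B → ℤ
  | [], _ => 0
  | q :: _, t => A.weight q t

variable {A}

/-- A transition that is possible after a history and consistent with `τ`. -/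
def Legal (τ : A.ModularStrategy) : List (Place N B) → Target N B → Prop
  | [], _ => False
  | q :: r, t => A.IsChoicePlace q ∧ (q, t) ∈ A.trans ∧
      (A.IsPlayer1 q → t = τ.toFun (A.placeModule q) (q :: r).reverse)

theorem Play.conf_eq (π : A.Play) (k : ℕ) : π.conf k = A.confs (π.conf 0) π.move k := by
  induction k with
  | zero => rfl
  | succ k ih => rw [π.conf_succ, ih, confs]

theorem Play.describes (π : A.Play) (k : ℕ) :
    A.Describes (π.conf k) ((List.range k).map π.conf).reverse
      (A.states (π.conf 0) π.move k) := by
  have := describes_states (A := A) (π.conf 0) π.move k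
  rwa [← funext π.conf_eq] at this

theorem Play.legal (π : A.Play) {τ : A.ModularStrategy} (hτ : π.Consistent τ) (k : ℕ) :
    Legal τ (A.states (π.conf 0) π.move k).hist (π.move k) ∧
      A.histWeight (A.states (π.conf 0) π.move k).hist (π.move k) =
        A.weight (A.place (π.conf k)) (π.move k) := by
  have hd := π.describes k
  have hl := hd.localHistory
  have hhead := hd.head
  have hcons := hτ k
  have hcan := π.canMove k
  rw [Play.localHistory, hl] at hcons
  generalize A.states (π.conf 0) π.move k = s at *
  obtain ⟨_ | ⟨q, r⟩, stk⟩ := s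
  · simp at hhead
  · simp only [List.head?_cons, Option.some.injEq] at hhead
    subst hhead
    exact ⟨⟨hcan.1, hcan.2, hcons⟩, rfl⟩

theorem exists_play {τ : A.ModularStrategy} {c : Config N B} {move : ℕ → Target N B}
    (h : ∀ k, Legal τ (A.states c move k).hist (move k)) :
    ∃ π : A.Play, π.conf 0 = c ∧ π.Consistent τ ∧ π.move = move := by
  have key : ∀ k, A.CanMove (A.confs c move k) (move k) ∧
      (A.IsPlayer1 (A.place (A.confs c move k)) →
        move k = τ.toFun (A.placeModule (A.place (A.confs c move k)))
          (A.states c move k).hist.reverse) := by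
    intro k
    have hd := describes_states (A := A) c move k
    have hhead := hd.head
    have hk := h k
    generalize A.states c move k = s at *
    obtain ⟨_ | ⟨q, r⟩, stk⟩ := s
    · simp at hhead
    · simp only [List.head?_cons, Option.some.injEq] at hhead
      subst hhead
      exact ⟨⟨hk.1, hk.2.1⟩, hk.2.2⟩
  refine ⟨⟨A.confs c move, move, fun k => (key k).1, fun k => rfl⟩, rfl, ?_, rfl⟩
  intro k hk
  have hd := describes_states (A := A) c move k
  rw [Play.localHistory, hd.localHistory]
  exact (key k).2 hk

/-! ### Finite segments of plays, and plays of negative mean weight. -/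

/-- `Seg τ s k w s'`: there are `k` transitions of total weight `w` from `s` to `s'`, consistent
with `τ`. -/
inductive Seg (τ : A.ModularStrategy) : HState N B → ℕ → ℤ → HState N B → Prop
  | refl (s : HState N B) : Seg τ s 0 0 s
  | head {s s' : HState N B} {t : Target N B} {k : ℕ} {w : ℤ} : Legal τ s.hist t →
      Seg τ (A.step s t) k w s' → Seg τ s (k + 1) (A.histWeight s.hist t + w) s'

theorem Seg.trans {τ : A.ModularStrategy} {s s' s'' : HState N B} {k k' : ℕ} {w w' : ℤ}
    (h : Seg τ s k w s') (h' : Seg τ s' k' w' s'') : Seg τ s (k + k') (w + w') s'' := by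
  induction h with
  | refl s => simpa using h'
  | head hl _ ih =>
    have := Seg.head hl (ih h')
    rwa [← add_assoc, Nat.add_right_comm] at this

theorem Seg.single {τ : A.ModularStrategy} {s s' : HState N B} {t : Target N B}
    (h : Legal τ s.hist t) (hs : A.step s t = s') : Seg τ s 1 (A.histWeight s.hist t) s' := by
  have := Seg.head h (Seg.refl (A.step s t))
  rw [hs] at this
  simpa using this

/-- The states that plays from `C₀` consistent with `τ` can reach. -/
def Reach (τ : A.ModularStrategy) (C₀ : Set (Config N B)) (s : HState N B) : Prop :=
  ∃ c ∈ C₀, ∃ k w, Seg τ (A.initState c) k w s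

theorem Reach.trans {τ : A.ModularStrategy} {C₀ : Set (Config N B)} {s s' : HState N B}
    (h : Reach τ C₀ s) {k : ℕ} {w : ℤ} (hs : Seg τ s k w s') : Reach τ C₀ s' := by
  obtain ⟨c, hc, k', w', h⟩ := h
  exact ⟨c, hc, _, _, h.trans hs⟩

theorem exists_abs_weight_le [Finite N] [Finite B] (A : WRG n N B) :
    ∃ W : ℤ, 0 ≤ W ∧ ∀ p t, |A.weight p t| ≤ W := by
  obtain ⟨W, hW⟩ := (Set.finite_range
    (fun x : Place N B × Target N B => |A.weight x.1 x.2|)).bddAbove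
  refine ⟨max W 0, le_max_right _ _, fun p t => le_max_of_le_left (hW ⟨(p, t), rfl⟩)⟩

theorem abs_histWeight_le {W : ℤ} (h0 : 0 ≤ W) (hW : ∀ p t, |A.weight p t| ≤ W)
    (h : List (Place N B)) (t : Target N B) : |A.histWeight h t| ≤ W := by
  cases h with
  | nil => simpa [histWeight] using h0
  | cons q r => exact hW q t

theorem Seg.le_weight {τ : A.ModularStrategy} {W : ℤ} (h0 : 0 ≤ W)
    (hW : ∀ p t, |A.weight p t| ≤ W) {s s' : HState N B} {k : ℕ} {w : ℤ} (h : Seg τ s k w s') :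
    -(k * W) ≤ w := by
  induction h with
  | refl s => simp
  | @head s s' t k w hl _ ih =>
    have := (abs_le.1 (abs_histWeight_le h0 hW s.hist t)).1
    push_cast
    linarith

theorem Play.limSupAvg_neg {π : A.Play} {M : ℕ} (hM : 0 < M) {C : ℤ}
    (h : ∀ k : ℕ, M * ∑ j ∈ Finset.range k, A.weight (A.place (π.conf j)) (π.move j) ≤ C - k) :
    π.limSupAvg < 0 := by
  have hM' : (0 : ℝ) < M := by exact_mod_cast hM
  have hlim : Tendsto (fun k : ℕ => ((((C : ℝ) / M) / (k : ℝ) - 1 / M : ℝ) : EReal)) atTop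
      (nhds (((0 : ℝ) - 1 / M : ℝ) : EReal)) := by
    refine (continuous_coe_real_ereal.tendsto _).comp ?_
    exact (tendsto_const_div_atTop_nhds_zero_nat _).sub_const _
  have hle : π.limSupAvg ≤ (((0 : ℝ) - 1 / M : ℝ) : EReal) := by
    rw [← hlim.limsup_eq]
    refine limsup_le_limsup ?_
    filter_upwards [eventually_gt_atTop 0] with k hk
    have hk' : (0 : ℝ) < k := by exact_mod_cast hk
    have h1 : (M : ℝ) * ((∑ j ∈ Finset.range k, A.weight (A.place (π.conf j)) (π.move j) : ℤ) : ℝ)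
        ≤ C - k := by exact_mod_cast h k
    rw [EReal.coe_le_coe_iff, Play.avg, div_le_iff₀ hk']
    rw [sub_mul, div_mul_cancel₀ _ hk'.ne', div_mul_eq_mul_div, one_mul, ← sub_div,
      le_div_iff₀ hM']
    linarith
  refine hle.trans_lt ?_
  have : (0 : ℝ) - 1 / M < 0 := by
    have := one_div_pos.2 hM'
    linarith
  exact_mod_cast this

theorem Play.limInfAvg_nonneg {π : A.Play} {C : ℤ}
    (h : ∀ k : ℕ, C ≤ ∑ j ∈ Finset.range k, A.weight (A.place (π.conf j)) (π.move j)) :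
    0 ≤ π.limInfAvg := by
  have hlim : Tendsto (fun k : ℕ => ((((C : ℝ)) / (k : ℝ) : ℝ) : EReal)) atTop
      (nhds ((0 : ℝ) : EReal)) :=
    (continuous_coe_real_ereal.tendsto _).comp (tendsto_const_div_atTop_nhds_zero_nat _)
  have : ((0 : ℝ) : EReal) ≤ π.limInfAvg := by
    rw [← hlim.liminf_eq]
    refine liminf_le_liminf ?_
    filter_upwards [eventually_gt_atTop 0] with k hk
    have hk' : (0 : ℝ) < k := by exact_mod_cast hk
    have h1 : (C : ℝ) ≤
        ((∑ j ∈ Finset.range k, A.weight (A.place (π.conf j)) (π.move j) : ℤ) : ℝ) := by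
      exact_mod_cast h k
    rw [EReal.coe_le_coe_iff, Play.avg]
    gcongr
  exact_mod_cast this

theorem Play.limInfAvg_le_limSupAvg (π : A.Play) : π.limInfAvg ≤ π.limSupAvg :=
  liminf_le_limsup

/-- A set of reachable states in which player 2 can decrease the total weight forever does not
exist if `τ` is winning. -/
theorem not_exists_decreasing_step {τ : A.ModularStrategy} {C₀ : Set (Config N B)}
    (hτ : τ.WinsLimSup C₀) {Q : HState N B → ℤ → Prop} {C : ℤ} {M : ℕ} (hM : 0 < M)
    (hC : ∀ s g, Q s g → g ≤ C)
    (hQ : ∀ s g, Q s g → ∃ t g', Legal τ s.hist t ∧ Q (A.step s t) g' ∧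
      M * A.histWeight s.hist t ≤ g' - g - 1) {c : Config N B} (hc : c ∈ C₀) {g : ℤ} :
    ¬ Q (A.initState c) g := by
  intro h0
  have : Nonempty (Target N B) := ⟨(hQ _ _ h0).choose⟩
  choose! nt ng hl hq hw using hQ
  let z : ℕ → HState N B × ℤ := fun k => Nat.rec (A.initState c, g)
    (fun _ z => (A.step z.1 (nt z.1 z.2), ng z.1 z.2)) k
  have hz : ∀ k, Q (z k).1 (z k).2 := by
    intro k
    induction k with
    | zero => exact h0
    | succ k ih => exact hq _ _ ih
  let move : ℕ → Target N B := fun k => nt (z k).1 (z k).2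
  have hs : ∀ k, A.states c move k = (z k).1 := by
    intro k
    induction k with
    | zero => rfl
    | succ k ih => rw [states, ih]
  have hlegal : ∀ k, Legal τ (A.states c move k).hist (move k) := fun k => by
    rw [hs]; exact hl _ _ (hz k)
  obtain ⟨π, hπ, hcons, hmove⟩ := exists_play hlegal
  have hsum : ∀ k : ℕ, M * ∑ j ∈ Finset.range k, A.weight (A.place (π.conf j)) (π.move j) ≤
      (z k).2 - g - k := by
    intro k
    induction k with
    | zero => simp [z]
    | succ k ih =>
      have h1 := (π.legal hcons k).2
      rw [hπ, hmove, hs] at h1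
      have h2 := hw _ _ (hz k)
      have h3 : (z (k + 1)).2 = ng (z k).1 (z k).2 := rfl
      rw [Finset.sum_range_succ, mul_add, hmove, ← h1, h3]
      rw [hmove] at ih
      push_cast
      have h4 : move k = nt (z k).1 (z k).2 := rfl
      rw [h4]
      linarith
  have := Play.limSupAvg_neg hM (C := C - g) (π := π) fun k =>
    (hsum k).trans (by have := hC _ _ (hz k); linarith)
  exact absurd (hτ π (hπ ▸ hc) hcons) (not_le.2 this)

/-- The elements of `X` are checkpoints joined by segments of at most `L` transitions. Progress per
segment is spread over single transitions, to which `not_exists_decreasing_step` applies. -/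
theorem not_exists_decreasing_seg [Finite N] [Finite B] {τ : A.ModularStrategy}
    {C₀ : Set (Config N B)} (hτ : τ.WinsLimSup C₀) {X : Type*} (s : X → HState N B)
    (P : X → Prop) (f : X → ℤ) {C : ℤ} {M L : ℕ} (hM : 0 < M) (hf : ∀ x, P x → f x ≤ C)
    (hP : ∀ x, P x → ∃ x' k w, P x' ∧ Seg τ (s x) k w (s x') ∧ 1 ≤ k ∧ k ≤ L ∧
      M * w ≤ f x' - f x - 1) {x : X} (hx : P x) : ¬ Reach τ C₀ (s x) := by
  rintro ⟨c, hc, k₀, w₀, hseg⟩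
  obtain ⟨W, hW0, hW⟩ := A.exists_abs_weight_le
  obtain ⟨x₁, k₁, w₁, hx₁, hseg₁, hk₁, hkL, -⟩ := hP x hx
  have hL : 0 < L := by omega
  -- `Q` holds at a state from which `k` transitions of weight `w` lead to checkpoint `x`. The term
  -- `-k` pays one unit per transition; the factor `L` makes the unit gained at a checkpoint cover a
  -- whole segment. The bound `k₀ + L` leaves room for the prefix from the initial configuration.
  refine not_exists_decreasing_step hτ (M := M * L)
    (Q := fun s' g => ∃ x k w, P x ∧ Seg τ s' k w (s x) ∧ 1 ≤ k ∧ k ≤ k₀ + L ∧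
      g = L * f x - M * L * w - k) (C := L * C + M * L * ((k₀ + L : ℕ) * W)) (by positivity)
    ?_ ?_ hc ⟨x₁, _, _, hx₁, hseg.trans hseg₁, by omega, by omega, rfl⟩
  · rintro s' g ⟨x, k, w, hx, hs, -, hk, rfl⟩
    have h1 := hs.le_weight hW0 hW
    have h2 : (k : ℤ) * W ≤ (k₀ + L : ℕ) * W := by gcongr
    have h3 : (L : ℤ) * f x ≤ L * C := by gcongr; exact hf x hx
    have h4 : (M : ℤ) * L * (-w) ≤ M * L * ((k₀ + L : ℕ) * W) := by gcongr; linarith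
    have h5 : (0 : ℤ) ≤ k := by positivity
    linarith
  · rintro s' g ⟨x, k, w, hx, hs, hk1, hk, rfl⟩
    cases hs with
    | refl => omega
    | @head _ _ t k w hl hs =>
      -- The current transition reaches the checkpoint; the next segment is appended at once to keep
      -- `1 ≤ k`.
      by_cases hk0 : k = 0
      · subst hk0
        obtain ⟨x₂, k₂, w₂, hx₂, hs₂, hk₂, hkL₂, hw₂⟩ := hP x hx
        refine ⟨t, _, hl, ⟨x₂, _, _, hx₂, hs.trans hs₂, by omega, by omega, rfl⟩, ?_⟩
        have h1 : (L : ℤ) * (M * w₂) ≤ L * (f x₂ - f x - 1) := by gcongr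
        have h2 : (k₂ : ℤ) ≤ L := by exact_mod_cast hkL₂
        push_cast
        linarith
      · refine ⟨t, _, hl, ⟨x, _, _, hx, hs, by omega, by omega, rfl⟩, ?_⟩
        push_cast
        linarith

end WRG

/-! ### Summaries. -/

/-- `M` selects an element of each nonempty set: the infimum if the set is bounded below, and
an element that is at most `-K` otherwise. -/
def IsSummary {α β : Type*} (K : ℤ) (S : α → β → Set ℤ) (M : α → β → ℤ) : Prop :=
  ∀ a b, (S a b).Nonempty → M a b ∈ S a b ∧ (BddBelow (S a b) → M a b = sInf (S a b)) ∧
    (¬ BddBelow (S a b) → M a b ≤ -K)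

theorem exists_isSummary {α β : Type*} (K : ℤ) (S : α → β → Set ℤ) : ∃ M, IsSummary K S M := by
  have : ∀ a b, ∃ m, (S a b).Nonempty → m ∈ S a b ∧ (BddBelow (S a b) → m = sInf (S a b)) ∧
      (¬ BddBelow (S a b) → m ≤ -K) := by
    intro a b
    by_cases hb : BddBelow (S a b)
    · exact ⟨sInf (S a b), fun hne => ⟨Int.csInf_mem hne hb, fun _ => rfl, fun h => absurd hb h⟩⟩
    · rw [not_bddBelow_iff] at hb
      obtain ⟨m, hm, hlt⟩ := hb (-K)
      exact ⟨m, fun _ => ⟨hm, fun h => absurd h (not_bddBelow_iff.2 hb), fun _ => hlt.le⟩⟩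
  choose M hM using this
  exact ⟨M, hM⟩

theorem exists_abs_le {α β : Type*} [Finite α] [Finite β] (f : α → β → ℤ) :
    ∃ C : ℤ, 0 ≤ C ∧ ∀ a b, |f a b| ≤ C := by
  obtain ⟨C, hC⟩ := (Set.finite_range (fun x : α × β => |f x.1 x.2|)).bddAbove
  exact ⟨max C 0, le_max_right _ _, fun a b => le_max_of_le_left (hC ⟨(a, b), rfl⟩)⟩

theorem exists_nat_le {α β : Type*} [Finite α] [Finite β] (f : α → β → ℕ) :
    ∃ C : ℕ, ∀ a b, f a b ≤ C := by
  obtain ⟨C, hC⟩ := (Set.finite_range (fun x : α × β => f x.1 x.2)).bddAbove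
  exact ⟨C, fun a b => hC ⟨(a, b), rfl⟩⟩

/-! ### Invocations under `τ`, and the local game and call game. -/

namespace WRG

open CycleGame

variable {n : ℕ} {N B : Type*} {A : WRG n N B}

/-- `LocalRun τ p h k w`: an invocation that starts at `p` can reach the local history `h` after
`k` transitions of total weight `w`, consistently with `τ`. -/
inductive LocalRun (τ : A.ModularStrategy) : Place N B → List (Place N B) → ℕ → ℤ → Prop
  | start (p : Place N B) : LocalRun τ p [p] 0 0
  | node {p : Place N B} {h : List (Place N B)} {k : ℕ} {w : ℤ} {v : N} : LocalRun τ p h k w →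
      Legal τ h (.node v) → v ∉ A.Ex →
      LocalRun τ p (.node v :: h) (k + 1) (w + A.histWeight h (.node v))
  | pass {p : Place N B} {h : List (Place N B)} {k : ℕ} {w : ℤ} {b : B} {e : N} :
      LocalRun τ p h k w → Legal τ h (.call b e) → e ∈ A.Ex →
      LocalRun τ p (.ret b e :: h) (k + 1) (w + A.histWeight h (.call b e))
  | call {p : Place N B} {h h' : List (Place N B)} {k k' : ℕ} {w w' : ℤ} {b : B} {e x : N} :
      LocalRun τ p h k w → Legal τ h (.call b e) → e ∉ A.Ex → LocalRun τ (.node e) h' k' w' →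
      Legal τ h' (.node x) → x ∈ A.Ex →
      LocalRun τ p (.ret b x :: h) (k + (1 + (k' + 1)))
        (w + (A.histWeight h (.call b e) + (w' + A.histWeight h' (.node x))))

theorem LocalRun.seg {τ : A.ModularStrategy} {p : Place N B} {h : List (Place N B)} {k : ℕ} {w : ℤ}
    (hr : LocalRun τ p h k w) (stk : Frames N B) : Seg τ ⟨[p], stk⟩ k w ⟨h, stk⟩ := by
  induction hr generalizing stk with
  | start p => exact .refl _
  | node _ hl hv ih => exact (ih stk).trans (.single hl (step_node hv _ _))
  | pass _ hl he ih => exact (ih stk).trans (.single hl (step_call_exit he _ _))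
  | call _ hl he _ hl' hx ih ih' =>
    exact (ih stk).trans ((Seg.single (s := ⟨_, stk⟩) hl (step_call he _ _)).trans
      ((ih' _).trans (.single hl' (step_exit hx _ _ _ _))))

theorem Legal.cons {τ : A.ModularStrategy} {h : List (Place N B)} {t : Target N B}
    (hl : Legal τ h t) : ∃ q r, h = q :: r ∧ A.IsChoicePlace q ∧ (q, t) ∈ A.trans := by
  cases h with
  | nil => exact hl.elim
  | cons q r => exact ⟨q, r, rfl, hl.1, hl.2.1⟩

/-- `ModularStrategy.legal` applies only to histories of choice places in one module; histories of
runs are of this kind. -/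
theorem LocalRun.choice {τ : A.ModularStrategy} {p : Place N B} {h : List (Place N B)} {k : ℕ}
    {w : ℤ} (hr : LocalRun τ p h k w) (hp : A.IsChoicePlace p) :
    ∀ q ∈ h, A.IsChoicePlace q ∧ A.placeModule q = A.placeModule p := by
  induction hr with
  | start p => simpa using hp
  | node hr hl hv ih =>
    intro q hq
    obtain ⟨q', r, rfl, -, htr⟩ := hl.cons
    rcases List.mem_cons.1 hq with rfl | hq
    · exact ⟨hv, (A.trans_module _ _ htr).symm.trans (ih hp q' (by simp)).2⟩
    · exact ih hp q hq
  | pass hr hl he ih =>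
    intro q hq
    obtain ⟨q', r, rfl, -, htr⟩ := hl.cons
    rcases List.mem_cons.1 hq with rfl | hq
    · exact ⟨⟨he, (A.trans_call _ _ _ htr).2⟩,
        (A.trans_module _ _ htr).symm.trans (ih hp q' (by simp)).2⟩
    · exact ih hp q hq
  | call hr hl he hr' hl' hx ih ih' =>
    intro q hq
    obtain ⟨q', r, rfl, -, htr⟩ := hl.cons
    obtain ⟨q'', r', rfl, -, htr'⟩ := hl'.cons
    rcases List.mem_cons.1 hq with rfl | hq
    · exact ⟨⟨hx, ((A.trans_module _ _ htr').symm.trans (ih' he q'' (by simp)).2).trans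
        (A.trans_call _ _ _ htr).2⟩, (A.trans_module _ _ htr).symm.trans (ih hp q' (by simp)).2⟩
    · exact ih hp q hq

/-- An invocation that starts at `p` can end at the exit `x`. -/
def ExitRun (τ : A.ModularStrategy) (p : Place N B) (x : N) (k : ℕ) (w : ℤ) : Prop :=
  x ∈ A.Ex ∧ ∃ h k' w', LocalRun τ p h k' w' ∧ Legal τ h (.node x) ∧ k = k' + 1 ∧
    w = w' + A.histWeight h (.node x)

/-- An invocation that starts at `p` can make a call with the entry `e`, which is not an exit. -/
def CallRun (τ : A.ModularStrategy) (p : Place N B) (e : N) (k : ℕ) (w : ℤ) : Prop :=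
  e ∉ A.Ex ∧ ∃ h b k' w', LocalRun τ p h k' w' ∧ Legal τ h (.call b e) ∧ k = k' + 1 ∧
    w = w' + A.histWeight h (.call b e)

/-- The weights of the invocations from `p` to the exit `x`. -/
def exitWeights (τ : A.ModularStrategy) (p : Place N B) (x : N) : Set ℤ :=
  {w | ∃ k, ExitRun τ p x k w}

/-- The weights of the incomplete invocations from `p` to a call with the entry `e`. -/
def callWeights (τ : A.ModularStrategy) (p : Place N B) (e : N) : Set ℤ :=
  {w | ∃ k, CallRun τ p e k w}

theorem ExitRun.seg {τ : A.ModularStrategy} {p : Place N B} {x : N} {k : ℕ} {w : ℤ}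
    (h : ExitRun τ p x k w) (b : B) (h' : List (Place N B)) (stk : Frames N B) :
    Seg τ ⟨[p], (b, h') :: stk⟩ k w ⟨.ret b x :: h', stk⟩ := by
  obtain ⟨hx, h, k', w', hr, hl, rfl, rfl⟩ := h
  exact (hr.seg _).trans (.single hl (step_exit hx _ _ _ _))

theorem CallRun.seg {τ : A.ModularStrategy} {p : Place N B} {e : N} {k : ℕ} {w : ℤ}
    (h : CallRun τ p e k w) (stk : Frames N B) :
    ∃ b h', Seg τ ⟨[p], stk⟩ k w ⟨[.node e], (b, h') :: stk⟩ := by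
  obtain ⟨he, h, b, k', w', hr, hl, rfl, rfl⟩ := h
  exact ⟨b, h, (hr.seg _).trans (.single hl (step_call he _ _))⟩

theorem LocalRun.exitRun {τ : A.ModularStrategy} {p : Place N B} {b : B} {e x : N}
    {h : List (Place N B)} {k k' : ℕ} {w w' : ℤ} (hr : LocalRun τ p h k w)
    (hl : Legal τ h (.call b e)) (he : e ∉ A.Ex) (h' : ExitRun τ (.node e) x k' w') :
    LocalRun τ p (.ret b x :: h) (k + (1 + k')) (w + (A.histWeight h (.call b e) + w')) := by
  obtain ⟨hx, h', k', w', hr', hl', rfl, rfl⟩ := h'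
  exact .call hr hl he hr' hl' hx

variable (A) in
/-- The edges between the places of a module, where a call is replaced by its summary `M`. -/
inductive LocalEdge (τ : A.ModularStrategy) (M : Place N B → N → ℤ) (q : Place N B) :
    Target N B → Place N B → ℤ → Prop
  | node {v : N} : v ∉ A.Ex → LocalEdge τ M q (.node v) (.node v) (A.weight q (.node v))
  | pass {b : B} {e : N} : e ∈ A.Ex →
      LocalEdge τ M q (.call b e) (.ret b e) (A.weight q (.call b e))
  | call {b : B} {e x : N} : e ∉ A.Ex → (exitWeights τ (.node e) x).Nonempty →
      LocalEdge τ M q (.call b e) (.ret b x) (A.weight q (.call b e) + M (.node e) x)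

/-- The value `w` is possible and optimal up to the bound given by the weights in `S`. -/
def Feasible (S : Set ℤ) (w : ℤ) : Prop := S.Nonempty ∧ (BddBelow S → sInf S ≤ w)

/-- The game played in one invocation of a module. Player 1 has to exit and to call with the
weights that `τ` guarantees. -/
def localGame (τ : A.ModularStrategy) (M : Place N B → N → ℤ) :
    CycleGame (Place N B) (Target N B) where
  -- A place without a choice falls to player 2, who has no legal move there; so it counts as won.
  P1 q := A.IsPlayer1 q ∧ A.IsChoicePlace q
  Leg q t := A.IsChoicePlace q ∧ (q, t) ∈ A.trans
  Out q t v w := LocalEdge A τ M q t v w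
  -- The oldest entry is the start of the invocation; removing cycles preserves it.
  Ok r t := ∀ p, r.getLast?.map Prod.fst = some p →
    (∀ x ∈ A.Ex, t = .node x →
      Feasible (exitWeights τ p x) (total r + A.histWeight (r.map Prod.fst) t)) ∧
    (∀ b, ∀ e ∉ A.Ex, t = .call b e →
      Feasible (callWeights τ p e) (total r + A.histWeight (r.map Prod.fst) t))

/-- The graph of the calls with the summary `D`, as a game of player 2 alone. -/
def callGame (τ : A.ModularStrategy) (D : Place N B → N → ℤ) : CycleGame (Place N B) N where
  P1 _ := False
  Leg _ _ := True
  Out p e v w := (callWeights τ p e).Nonempty ∧ v = .node e ∧ w = D p e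
  Ok _ _ := True

theorem potential_le [Finite N] [Finite B] {r : List (Place N B × ℤ)} {b : ℤ} (hb : 0 ≤ b)
    (hnd : (r.map Prod.fst).Nodup) (hr : ∀ y ∈ r, y.2 ≤ b) (c : ℕ) :
    potential c r ≤ c * (Nat.card (Place N B) * b) + Nat.card (Place N B) := by
  have h1 := length_le_card hnd
  have h2 := total_le hb hr h1
  have h3 : (r.length : ℤ) ≤ Nat.card (Place N B) := by exact_mod_cast h1
  have h4 : (c : ℤ) * total r ≤ c * (Nat.card (Place N B) * b) := by gcongr
  rw [potential]
  linarith

/-- The place `p` starts an invocation in a play from `C₀` consistent with `τ`. -/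
def Starts (τ : A.ModularStrategy) (C₀ : Set (Config N B)) (p : Place N B) : Prop :=
  ∃ stk, Reach τ C₀ ⟨[p], stk⟩

theorem Starts.of_callWeights {τ : A.ModularStrategy} {C₀ : Set (Config N B)} {p : Place N B}
    {e : N} (hp : Starts τ C₀ p) (h : (callWeights τ p e).Nonempty) : Starts τ C₀ (.node e) := by
  obtain ⟨stk, hr⟩ := hp
  obtain ⟨w, k, h⟩ := h
  obtain ⟨b, h', hs⟩ := h.seg stk
  exact ⟨_, hr.trans hs⟩

/-- Summary values are attained and there are finitely many of them, so runs of uniformly bounded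
length realise them. -/
theorem exists_length {S : Place N B → N → Set ℤ} {R : Place N B → N → ℕ → ℤ → Prop}
    (hS : ∀ p x, S p x = {w | ∃ k, R p x k w}) {K : ℤ} {M : Place N B → N → ℤ}
    (hM : IsSummary K S M) [Finite N] [Finite B] :
    ∃ L : ℕ, ∀ p x, (S p x).Nonempty → ∃ k ≤ L, R p x k (M p x) := by
  have : ∀ p x, ∃ k, (S p x).Nonempty → R p x k (M p x) := by
    intro p x
    by_cases h : (S p x).Nonempty
    · have := (hM p x h).1
      rw [hS] at this
      obtain ⟨k, hk⟩ := this
      exact ⟨k, fun _ => hk⟩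
    · exact ⟨0, fun h' => absurd h' h⟩
  choose kf hkf using this
  obtain ⟨L, hL⟩ := exists_nat_le kf
  exact ⟨L, fun p x h => ⟨_, hL p x, hkf p x h⟩⟩

/-- Otherwise player 2 keeps making calls without any return to the suspended invocations, closing
only negative cycles of the call graph. -/
theorem win_callGame [Finite N] [Finite B] {τ : A.ModularStrategy} {C₀ : Set (Config N B)}
    (hτ : τ.WinsLimSup C₀) {K : ℤ} {D : Place N B → N → ℤ} (hD : IsSummary K (callWeights τ) D)
    {p : Place N B} (hp : Starts τ C₀ p) : (callGame τ D).Win [(p, 0)] := by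
  by_contra hwin
  obtain ⟨stk, hreach⟩ := hp
  obtain ⟨b, hb, hDb⟩ := exists_abs_le D
  obtain ⟨L, hL⟩ := exists_length (R := CallRun τ) (fun _ _ => rfl) hD
  set c := Nat.card (Place N B) with hc
  refine not_exists_decreasing_seg hτ (X := HState N B × List (Place N B × ℤ)) Prod.fst
    (fun x => ∃ q a r, x.1.hist = [q] ∧ x.2 = (q, a) :: r ∧
      Along (fun r => ¬ (callGame τ D).Win r) x.2 ∧ (x.2.map Prod.fst).Nodup ∧
      ∀ y ∈ x.2, y.2 ≤ b)
    (fun x => potential (c + 1) x.2) (M := c + 1) (L := L) (by omega)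
    (C := (c + 1 : ℕ) * (c * b) + c) ?_ ?_ (x := (⟨[p], stk⟩, [(p, 0)])) ?_ hreach
  · rintro ⟨s, r⟩ ⟨q, a, r', h1, h2, h3, h4, h5⟩
    exact potential_le hb h4 h5 _
  · rintro ⟨⟨_, stk⟩, _⟩ ⟨q, a, r, rfl, rfl, hal, hnd, hle⟩
    rcases (callGame τ D).exists_not_good (hal.self (by simp)) with ⟨h, -⟩ | ⟨-, e, -, hg⟩
    · exact h.elim
    · obtain ⟨v, w, ⟨hne, rfl, rfl⟩, hal', hneg⟩ :=
        (callGame τ D).exists_of_not_good hal hg trivial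
      obtain ⟨k, hk, hrun⟩ := hL q e hne
      obtain ⟨b', h', hs⟩ := hrun.seg stk
      obtain ⟨a', r', hr'⟩ := extend_eq_cons ((q, a) :: r) (.node e : Place N B) (D q e)
      refine ⟨(⟨[.node e], (b', h') :: stk⟩, extend ((q, a) :: r) (.node e) (D q e)), k, D q e,
        ⟨.node e, a', r', rfl, hr', hal', nodup_extend hnd _ _,
          forall_mem_extend (P := fun x => x ≤ b) hle _ (abs_le.1 (hDb _ _)).2⟩, hs, ?_, hk, ?_⟩
      · obtain ⟨-, h, b, k', w', -, -, rfl, -⟩ := hrun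
        omega
      · exact potential_extend (length_le_card hnd) hneg
  · exact ⟨p, 0, [], rfl, rfl, along_singleton hwin, by simp, by simpa using hb⟩

/-- Otherwise player 2 defeats `τ` inside a single invocation: summary edges are replaced by runs
realising them exactly, and all closed cycles are negative. -/
theorem win_localGame [Finite N] [Finite B] {τ : A.ModularStrategy} {C₀ : Set (Config N B)}
    (hτ : τ.WinsLimSup C₀) {K : ℤ} {M : Place N B → N → ℤ} (hM : IsSummary K (exitWeights τ) M)
    {p : Place N B} (hp : Starts τ C₀ p) : (localGame τ M).Win [(p, 0)] := by
  by_contra hwin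
  obtain ⟨stk, hreach⟩ := hp
  obtain ⟨W, hW, hWb⟩ := A.exists_abs_weight_le
  obtain ⟨b, hb, hMb⟩ := exists_abs_le M
  obtain ⟨L, hL⟩ := exists_length (R := ExitRun τ) (fun _ _ => rfl) hM
  have hchoice : A.IsChoicePlace p := by
    by_contra h
    exact hwin (((localGame τ M).win_iff).2
      ⟨fun h' => absurd h'.2 h, fun _ t ht => absurd ht.1 h⟩)
  set c := Nat.card (Place N B) with hc
  refine not_exists_decreasing_seg hτ (X := List (Place N B) × List (Place N B × ℤ))
    (fun x => ⟨x.1, stk⟩)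
    (fun x => ∃ q a r h k w, x.1 = q :: h ∧ x.2 = (q, a) :: r ∧
      Along (fun r => ¬ (localGame τ M).Win r) x.2 ∧ (x.2.map Prod.fst).Nodup ∧
      (∀ y ∈ x.2, y.2 ≤ W + b) ∧ LocalRun τ p x.1 k w ∧ w ≤ total x.2 ∧
      x.2.getLast? = some (p, 0))
    (fun x => potential (c + 1) x.2) (M := c + 1) (L := L + 1) (by omega)
    (C := (c + 1 : ℕ) * (c * (W + b)) + c) ?_ ?_ (x := ([p], [(p, 0)])) ?_ hreach
  · rintro ⟨h, r⟩ ⟨q, a, r', h, k, w, h1, h2, h3, h4, h5, -⟩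
    exact potential_le (by omega) h4 h5 _
  · rintro ⟨_, _⟩ ⟨q, a, r, h, k, w, rfl, rfl, hal, hnd, hle, hrun, hw, hlast⟩
    -- If player 1 owns `q`, all her moves are bad, including that of `τ`; otherwise player 2 picks
    -- a bad move.
    have hmove : ∃ t, Legal τ (q :: h) t ∧ ¬ (localGame τ M).Good ((q, a) :: r) q t := by
      rcases (localGame τ M).exists_not_good (hal.self (by simp)) with ⟨h1, h2⟩ | ⟨h1, t, h2, h3⟩
      · have hall := hrun.choice hchoice
        have htr := τ.legal (A.placeModule q) h.reverse q (by
          intro q' hq'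
          have hq' : q' ∈ q :: h := by simpa [or_comm] using hq'
          exact ⟨(hall q' hq').1, (hall q' hq').2.trans (hall q (by simp)).2.symm⟩) h1.1
        rw [← List.reverse_cons] at htr
        exact ⟨_, ⟨h1.2, htr, fun _ => rfl⟩, h2 _ ⟨h1.2, htr⟩⟩
      · exact ⟨t, ⟨h2.1, h2.2, fun h => absurd ⟨h, h2.1⟩ h1⟩, h3⟩
    obtain ⟨t, hlegal, hg⟩ := hmove
    -- Player 1 cannot lose by violating `Ok`: the removed cycles were negative, so the real run
    -- weighs at most the total of the position, and its continuation belongs to the set whose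
    -- infimum is demanded.
    have hok : (localGame τ M).Ok ((q, a) :: r) t := by
      intro p' hp'
      rw [hlast] at hp'
      obtain rfl : p = p' := by simpa using hp'
      refine ⟨?_, ?_⟩
      · rintro x hx rfl
        have hmem : w + A.weight q (.node x) ∈ exitWeights τ p x :=
          ⟨_, hx, _, _, _, hrun, hlegal, rfl, rfl⟩
        exact ⟨⟨_, hmem⟩, fun hbd => (csInf_le hbd hmem).trans (by
          have : A.histWeight (((q, a) :: r).map Prod.fst) (.node x) = A.weight q (.node x) := rfl
          rw [this]; simpa using hw)⟩
      · rintro b' e he rfl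
        have hmem : w + A.weight q (.call b' e) ∈ callWeights τ p e :=
          ⟨_, he, _, _, _, _, hrun, hlegal, rfl, rfl⟩
        exact ⟨⟨_, hmem⟩, fun hbd => (csInf_le hbd hmem).trans (by
          have : A.histWeight (((q, a) :: r).map Prod.fst) (.call b' e) = A.weight q (.call b' e) :=
            rfl
          rw [this]; simpa using hw)⟩
    obtain ⟨v, w', hout, hal', hneg⟩ := (localGame τ M).exists_of_not_good hal hg hok
    obtain ⟨a', r', hr'⟩ := extend_eq_cons ((q, a) :: r) v w'
    have hpot := potential_extend (c := c) (length_le_card hnd) hneg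
    have htot := total_add_le_total_extend hneg
    have hnd' := nodup_extend hnd v w'
    have hlast' := (getLast?_extend (r := (q, a) :: r) (by simp) v w').trans hlast
    have hup : w' ≤ W + b → ∀ y ∈ extend ((q, a) :: r) v w', y.2 ≤ W + b :=
      fun h => forall_mem_extend (P := fun x => x ≤ W + b) hle _ h
    cases hout with
    | @node v hv =>
      exact ⟨(.node v :: q :: h, _), 1, _, ⟨_, a', r', _, _, _, rfl, hr', hal', hnd',
        hup (by have := (abs_le.1 (hWb q (.node v))).2; linarith),
        .node hrun hlegal hv, (add_le_add_left hw _).trans htot, hlast'⟩,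
        .single hlegal (step_node hv _ _), le_rfl, by omega, hpot⟩
    | @pass b' e he =>
      exact ⟨(.ret b' e :: q :: h, _), 1, _, ⟨_, a', r', _, _, _, rfl, hr', hal', hnd',
        hup (by have := (abs_le.1 (hWb q (.call b' e))).2; linarith),
        .pass hrun hlegal he, (add_le_add_left hw _).trans htot, hlast'⟩,
        .single hlegal (step_call_exit he _ _), le_rfl, by omega, hpot⟩
    | @call b' e x he hne =>
      obtain ⟨k', hk', hrun'⟩ := hL _ _ hne
      refine ⟨(.ret b' x :: q :: h, _), 1 + k', _, ⟨_, a', r', _, _, _, rfl, hr', hal', hnd',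
        hup (by
          have h1 := (abs_le.1 (hWb q (.call b' e))).2
          have h2 := (abs_le.1 (hMb (.node e) x)).2
          linarith),
        hrun.exitRun hlegal he hrun', (add_le_add_left hw _).trans htot, hlast'⟩,
        (Seg.single (s := ⟨q :: h, stk⟩) hlegal (step_call he _ _)).trans (hrun'.seg _ _ _),
        by omega, by omega, hpot⟩
  · exact ⟨p, 0, [], [], 0, 0, rfl, rfl, along_singleton hwin, by simp, by simp; omega, .start p,
      by simp [total], by simp⟩

end WRG

/-! ### A potential with exceptions that are controlled by a rank. -/

/-- The effect of a transition on the potential `value` of a state, on the number `cnt` of heavy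
edges of a history and on the `rank` of a state. -/
inductive Change {N B : Type*} (value : List (Place N B) → Frames N B → ℤ)
    (cnt : List (Place N B) → ℕ) (rank : List (Place N B) → Frames N B → ℕ) :
    HState N B → ℤ → HState N B → Prop
  | internal {q' q : Place N B} {h : List (Place N B)} {stk : Frames N B} {w : ℤ} :
      value (q' :: q :: h) stk ≤ value (q :: h) stk + w → cnt (q :: h) ≤ cnt (q' :: q :: h) →
      rank (q :: h) stk ≤ rank (q' :: q :: h) stk →
      Change value cnt rank ⟨q :: h, stk⟩ w ⟨q' :: q :: h, stk⟩
  | call {q p : Place N B} {b : B} {h : List (Place N B)} {stk : Frames N B} {w : ℤ} :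
      value [p] ((b, q :: h) :: stk) ≤ value (q :: h) stk + w →
      rank (q :: h) stk ≤ rank [p] ((b, q :: h) :: stk) →
      Change value cnt rank ⟨q :: h, stk⟩ w ⟨[p], (b, q :: h) :: stk⟩
  | ret {q q' p : Place N B} {b : B} {h h' : List (Place N B)} {stk : Frames N B} {w : ℤ} :
      cnt (q' :: h') ≤ cnt (p :: q' :: h') → rank (q' :: h') stk ≤ rank (p :: q' :: h') stk →
      (value (p :: q' :: h') stk ≤ value (q :: h) ((b, q' :: h') :: stk) + w ∨
        0 < cnt (p :: q' :: h') ∧ rank (q' :: h') stk < rank (p :: q' :: h') stk) →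
      (0 < cnt (q :: h) →
        0 < cnt (p :: q' :: h') ∧ rank (q' :: h') stk < rank (p :: q' :: h') stk) →
      Change value cnt rank ⟨q :: h, (b, q' :: h') :: stk⟩ w ⟨p :: q' :: h', stk⟩
  | bottom {q p : Place N B} {b : B} {h : List (Place N B)} {stk : Frames N B} {w : ℤ} :
      Change value cnt rank ⟨q :: h, (b, []) :: stk⟩ w ⟨[p], stk⟩

namespace Change

variable {N B : Type*} {value : List (Place N B) → Frames N B → ℤ}
  {cnt : List (Place N B) → ℕ} {rank : List (Place N B) → Frames N B → ℕ}

/-- The invocation at height `H` and those above it have rank at least `R`. -/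
inductive Above (rank : List (Place N B) → Frames N B → ℕ) (R H : ℕ) :
    List (Place N B) → Frames N B → Prop
  | base {h : List (Place N B)} {stk : Frames N B} : h ≠ [] → stk.length = H → R ≤ rank h stk →
      Above rank R H h stk
  | up {h h' : List (Place N B)} {b : B} {stk : Frames N B} : h ≠ [] → Above rank R H h' stk →
      rank h' stk ≤ rank h ((b, h') :: stk) → Above rank R H h ((b, h') :: stk)

theorem Above.le_rank {R H : ℕ} {h : List (Place N B)} {stk : Frames N B}
    (ha : Above rank R H h stk) : R ≤ rank h stk := by
  induction ha with
  | base _ _ h => exact h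
  | up _ _ hr ih => exact ih.trans hr

theorem Above.ne_nil {R H : ℕ} {h : List (Place N B)} {stk : Frames N B}
    (ha : Above rank R H h stk) : h ≠ [] := by
  cases ha <;> assumption

theorem Above.mono {R H : ℕ} {h h₂ : List (Place N B)} {stk : Frames N B}
    (ha : Above rank R H h stk) (hne : h₂ ≠ []) (hr : rank h stk ≤ rank h₂ stk) :
    Above rank R H h₂ stk := by
  cases ha with
  | base _ hl hR => exact .base hne hl (hR.trans hr)
  | up _ ha' hr' => exact .up hne ha' (hr'.trans hr)

theorem Above.pop {R H : ℕ} {h h' : List (Place N B)} {b : B} {stk : Frames N B}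
    (ha : Above rank R H h ((b, h') :: stk)) (hl : H ≤ stk.length) : Above rank R H h' stk := by
  cases ha with
  | base _ hl' _ =>
    simp only [List.length_cons] at hl'
    omega
  | up _ ha' _ => exact ha'

/-- A call or an internal move does not lower the rank, and a return leads to at least the rank of
the suspended caller. `bottom` is excluded because the frames from height `H` up have nonempty
histories. -/
theorem above_step {R H : ℕ} {s s' : HState N B} {w : ℤ} (hc : Change value cnt rank s w s')
    (ha : Above rank R H s.hist s.stk) (hl : H ≤ s'.stk.length) :
    Above rank R H s'.hist s'.stk := by
  cases hc with
  | internal _ _ hr => exact ha.mono (by simp) hr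
  | call _ hr => exact .up (by simp) ha hr
  | ret _ hr _ _ => exact (ha.pop hl).mono (by simp) hr
  | bottom => exact absurd rfl (ha.pop hl).ne_nil

/-- Some invocation above height `H` has used a heavy edge. -/
inductive Hot (cnt : List (Place N B) → ℕ) (H : ℕ) : List (Place N B) → Frames N B → Prop
  | here {h : List (Place N B)} {stk : Frames N B} : H < stk.length → 0 < cnt h → Hot cnt H h stk
  | under {h h' : List (Place N B)} {b : B} {stk : Frames N B} : Hot cnt H h' stk →
      Hot cnt H h ((b, h') :: stk)

theorem Hot.lt {H : ℕ} {h : List (Place N B)} {stk : Frames N B} (hh : Hot cnt H h stk) :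
    H < stk.length := by
  induction hh with
  | here h _ => exact h
  | under _ ih => exact ih.trans (by simp)

theorem Hot.mono {H : ℕ} {h h₂ : List (Place N B)} {stk : Frames N B} (hh : Hot cnt H h stk)
    (hc : cnt h ≤ cnt h₂) : Hot cnt H h₂ stk := by
  cases hh with
  | here hl h0 => exact .here hl (h0.trans_le hc)
  | under hh => exact .under hh

/-- A returning invocation with a heavy edge gives one to its caller, so heat can vanish only by a
descent to height `H`. -/
theorem hot_step {R H H' : ℕ} {s s' : HState N B} {w : ℤ} (hc : Change value cnt rank s w s')
    (hh : Hot cnt H s.hist s.stk) (ha : Above rank R H' s.hist s.stk) (hl' : H' ≤ s'.stk.length)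
    (hl : H < s'.stk.length) : Hot cnt H s'.hist s'.stk := by
  cases hc with
  | internal _ hm _ => exact hh.mono hm
  | call _ _ => exact .under hh
  | ret hm _ _ hp =>
    cases hh with
    | here _ h0 => exact .here hl (hp h0).1
    | under hh => exact hh.mono hm
  | bottom => exact absurd rfl (ha.pop hl').ne_nil

/-- The descent itself is a return from a hot invocation, so it strictly raises the rank of the
caller. -/
theorem rank_lt_of_hot {R H H' : ℕ} {s s' : HState N B} {w : ℤ}
    (hc : Change value cnt rank s w s') (hh : Hot cnt H s.hist s.stk)
    (ha : Above rank R H' s.hist s.stk) (hl' : H' ≤ s'.stk.length) (hl : s'.stk.length ≤ H) :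
    R < rank s'.hist s'.stk := by
  have hlt := hh.lt
  cases hc with
  | internal _ _ _ => exact absurd hlt (not_lt.2 hl)
  | call _ _ => exact absurd (hlt.trans (by simp)) (not_lt.2 hl)
  | ret _ _ _ hp =>
    cases hh with
    | here _ h0 => exact (ha.pop hl').le_rank.trans_lt (hp h0).2
    | under hh => exact absurd hh.lt (not_lt.2 hl)
  | bottom => exact absurd rfl (ha.pop hl').ne_nil

theorem exists_first_min (f : ℕ → ℕ) (u : ℕ) :
    ∃ t, u ≤ t ∧ (∀ v, t ≤ v → f t ≤ f v) ∧ ∀ v, u ≤ v → v < t → f t < f v := by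
  classical
  have hex : ∃ m, ∃ v, u ≤ v ∧ f v = m := ⟨_, u, le_rfl, rfl⟩
  have hm := Nat.find_spec hex
  have hmin : ∀ v, u ≤ v → Nat.find hex ≤ f v := fun v hv => Nat.find_le ⟨v, hv, rfl⟩
  have ht := Nat.find_spec hm
  refine ⟨Nat.find hm, ht.1, fun v hv => ?_, fun v hv hlt => ?_⟩
  · rw [ht.2]; exact hmin v (ht.1.trans hv)
  · rw [ht.2]
    exact lt_of_le_of_ne (hmin v hv) fun h => Nat.find_min hm hlt ⟨hv, h.symm⟩

/-- After a suitable time the potential never gains more than the weight, so its lower bound bounds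
the sums of weights. -/
theorem exists_le_sum {s : ℕ → HState N B} {w : ℕ → ℤ}
    (hs : ∀ k, Change value cnt rank (s k) (w k) (s (k + 1))) {C : ℤ}
    (hv : ∀ k, C ≤ value (s k).hist (s k).stk) {m : ℕ}
    (hr : ∀ k, rank (s k).hist (s k).stk ≤ m) :
    ∃ C', ∀ k, C' ≤ ∑ j ∈ Finset.range k, w j := by
  classical
  set len : ℕ → ℕ := fun k => (s k).stk.length with hlen
  set rk : ℕ → ℕ := fun k => rank (s k).hist (s k).stk with hrk
  -- Among the times after which the height is never lower, `T` has maximal rank. Such times exist,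
  -- and the ranks are bounded.
  obtain ⟨T, hT, hTmax⟩ : ∃ T, (∀ v, T ≤ v → len T ≤ len v) ∧
      ∀ t, (∀ v, t ≤ v → len t ≤ len v) → rk t ≤ rk T := by
    have hne : (rk '' {t | ∀ v, t ≤ v → len t ≤ len v}).Nonempty := by
      obtain ⟨t, -, ht, -⟩ := exists_first_min len 0
      exact ⟨_, t, ht, rfl⟩
    have hbd : BddAbove (rk '' {t | ∀ v, t ≤ v → len t ≤ len v}) :=
      ⟨m, by rintro _ ⟨t, -, rfl⟩; exact hr t⟩
    obtain ⟨T, hT, hTe⟩ := Nat.sSup_mem hne hbd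
    exact ⟨T, hT, fun t ht => hTe ▸ le_csSup hbd ⟨t, ht, rfl⟩⟩
  have habove : ∀ u, T ≤ u → Above rank (rk T) (len T) (s u).hist (s u).stk := by
    intro u hu
    induction u, hu using Nat.le_induction with
    | base =>
      refine .base ?_ rfl le_rfl
      have := hs T
      generalize s T = s₁ at this ⊢
      generalize s (T + 1) = s₂ at this
      cases this <;> simp
    | succ u hu ih => exact above_step (hs u) ih (hT _ (by omega))
  have hval : ∀ u, T ≤ u → value (s (u + 1)).hist (s (u + 1)).stk ≤
      value (s u).hist (s u).stk + w u := by
    intro u hu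
    by_contra hneg
    have hlu := hT (u + 1) (by omega)
    have hstep : 0 < cnt (s (u + 1)).hist ∧ rk T < rk (u + 1) := by
      have hc := hs u
      have ha := habove u hu
      simp only [hlen, hrk] at hlu ⊢
      generalize s u = s₁ at *
      generalize s (u + 1) = s₂ at *
      cases hc with
      | internal h _ _ => exact absurd h hneg
      | call h _ => exact absurd h hneg
      | ret _ _ h _ =>
        have := h.resolve_left hneg
        exact ⟨this.1, (ha.pop hlu).le_rank.trans_lt this.2⟩
      | bottom => exact absurd rfl (ha.pop hlu).ne_nil
    -- An exception at `u` has raised the rank and left a heavy edge. At the first later time `t` of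
    -- minimal height, the rank still exceeds that at `T`: either `t = u + 1`, or the heat persists
    -- until the return that reaches `t`.
    obtain ⟨t, hut, ht, hlt⟩ := exists_first_min len (u + 1)
    rcases hut.eq_or_lt with rfl | hut'
    · exact absurd (hTmax _ ht) (not_le.2 hstep.2)
    · have hhot : ∀ v, u + 1 ≤ v → v < t → Hot cnt (len t) (s v).hist (s v).stk := by
        intro v hv
        induction v, hv using Nat.le_induction with
        | base => exact fun h => .here (hlt _ le_rfl h) hstep.1
        | succ v hv ih =>
          intro h
          exact hot_step (hs v) (ih (by omega)) (habove v (by omega)) (hT _ (by omega))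
            (hlt _ (by omega) h)
      obtain ⟨v, rfl⟩ : ∃ v, t = v + 1 := ⟨t - 1, by omega⟩
      have := rank_lt_of_hot (hs v) (hhot v (by omega) (by omega)) (habove v (by omega))
        (hT _ (by omega)) le_rfl
      exact absurd (hTmax _ ht) (not_le.2 this)
  refine ⟨-(∑ j ∈ Finset.range T, |w j|) - |C - value (s T).hist (s T).stk|, fun k => ?_⟩
  have habs : ∀ k, k ≤ T → -(∑ j ∈ Finset.range T, |w j|) ≤ ∑ j ∈ Finset.range k, w j := by
    intro k hk
    have h1 : ∑ j ∈ Finset.range k, |w j| ≤ ∑ j ∈ Finset.range T, |w j| :=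
      Finset.sum_le_sum_of_subset_of_nonneg (Finset.range_mono hk) fun _ _ _ => abs_nonneg _
    have h2 := Finset.abs_sum_le_sum_abs w (Finset.range k)
    have h3 := neg_abs_le (∑ j ∈ Finset.range k, w j)
    linarith
  have h0 := abs_nonneg (C - value (s T).hist (s T).stk)
  rcases le_total k T with hk | hk
  · have := habs k hk
    linarith
  · have h1 : ∑ j ∈ Finset.range T, w j + value (s k).hist (s k).stk -
        value (s T).hist (s T).stk ≤ ∑ j ∈ Finset.range k, w j := by
      induction k, hk using Nat.le_induction with
      | base => linarith
      | succ k hk ih =>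
        rw [Finset.sum_range_succ]
        have := hval k hk
        linarith
    have h2 := habs T le_rfl
    have h3 := neg_abs_le (C - value (s T).hist (s T).stk)
    have h4 := hv k
    linarith

end Change

/-! ### The improved strategy and its invariants. -/

namespace WRG

open CycleGame

variable {n : ℕ} {N B : Type*} {A : WRG n N B}

/-- The place at which the invocation with the local history `q :: h` started. -/
def first (q : Place N B) (h : List (Place N B)) : Place N B :=
  (q :: h).getLast (List.cons_ne_nil q h)

theorem first_cons (q' q : Place N B) (h : List (Place N B)) : first q' (q :: h) = first q h :=
  List.getLast_cons _

section Improved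

variable [Nonempty N] (τ : A.ModularStrategy) (M D : Place N B → N → ℤ)

instance : Nonempty (Target N B) := ⟨.node (Classical.arbitrary N)⟩

/-- The memory of player 1 after a local history. -/
noncomputable def memory : List (Place N B) → List (Place N B × ℤ)
  | [] => []
  | [q] => [(q, 0)]
  | q' :: q :: h => (localGame τ M).update (memory (q :: h)) q q'

theorem memory_eq_cons (q : Place N B) (h : List (Place N B)) :
    ∃ a r, memory τ M (q :: h) = (q, a) :: r := by
  cases h with
  | nil => exact ⟨0, [], rfl⟩
  | cons q' h => exact extend_eq_cons _ _ _

theorem getLast?_memory (q : Place N B) (h : List (Place N B)) :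
    (memory τ M (q :: h)).getLast?.map Prod.fst = some (first q h) := by
  induction h generalizing q with
  | nil => rfl
  | cons q' h ih =>
    obtain ⟨a, r, hr⟩ := memory_eq_cons τ M q' h
    rw [first_cons, ← ih q', memory, CycleGame.update, getLast?_extend (by simp [hr])]

open Classical in
/-- The move of the improved strategy after a local history. -/
noncomputable def improvedMove : List (Place N B) → Target N B
  | [] => Classical.arbitrary _
  | q :: h =>
    if ∃ t, (localGame τ M).Leg q t ∧ (localGame τ M).Good (memory τ M (q :: h)) q t then
      (localGame τ M).choice (memory τ M (q :: h)) q
    else τ.toFun (A.placeModule q) (q :: h).reverse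

/-- The strategy that plays the local games with the memory obtained by removing cycles. -/
noncomputable def improved : A.ModularStrategy where
  toFun _ h := improvedMove τ M h.reverse
  legal i h p hall hp := by
    rw [List.reverse_append]
    show (p, improvedMove τ M (p :: h.reverse)) ∈ A.trans
    rw [improvedMove]
    -- Histories without a winning move also need a legal value; there `τ` supplies it.
    split_ifs with hex
    · exact ((localGame τ M).choice_spec hex).1.2
    · have hi : A.placeModule p = i := (hall p (by simp)).2
      rw [List.reverse_cons, List.reverse_reverse, hi]
      exact τ.legal i h p hall hp

/-- The memory of player 2 in the graph of calls. -/
noncomputable def callMemory : Place N B → Frames N B → List (Place N B × ℤ)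
  | p, [] => [(p, 0)]
  | p, (_, []) :: _ => [(p, 0)]
  | p, (_, q :: h) :: stk =>
    (callGame τ D).update (callMemory (first q h) stk) (first q h) p

/-- The weight of the call that starts an invocation at `p`. -/
def callWeight (A : WRG n N B) (q : Place N B) (b : B) : Place N B → ℤ
  | .node e => A.weight q (.call b e)
  | .ret _ _ => 0

/-- The potential of the suspended invocations. -/
noncomputable def framesValue : Place N B → Frames N B → ℤ
  | _, [] => 0
  | _, (_, []) :: _ => 0
  | p, (b, q :: h) :: stk =>
    framesValue (first q h) stk + (total (memory τ M (q :: h)) + A.callWeight q b p)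

/-- The potential of a state. -/
noncomputable def value : List (Place N B) → Frames N B → ℤ
  | [], _ => 0
  | q :: h, stk => framesValue τ M (first q h) stk + total (memory τ M (q :: h))

/-- A measure that increases with the heavy edges that are used. -/
noncomputable def rank (K K' : ℤ) : List (Place N B) → Frames N B → ℕ
  | [], _ => 0
  | q :: h, stk => heavy K' (callMemory τ D (first q h) stk) * (Nat.card (Place N B) + 1) +
      heavy K (memory τ M (q :: h))

/-- The properties of the summaries `M` and `D` and of the bounds on their weights. -/
structure Setting (C₀ : Set (Config N B)) (W b b' K d d' K' : ℤ) : Prop where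
  weight_le : ∀ p t, |A.weight p t| ≤ W
  summary : IsSummary (K + W) (exitWeights τ) M
  callSummary : IsSummary K' (callWeights τ) D
  win : ∀ p, Starts τ C₀ p → (localGame τ M).Win [(p, 0)]
  callWin : ∀ p, Starts τ C₀ p → (callGame τ D).Win [(p, 0)]
  b_nonneg : 0 ≤ b
  b'_nonneg : 0 ≤ b'
  d_nonneg : 0 ≤ d
  d'_nonneg : 0 ≤ d'
  le_b : ∀ q t v w, (localGame τ M).Out q t v w → w ≤ b
  ge_b' : ∀ q t v w, (localGame τ M).Out q t v w → -b' ≤ w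
  le_d : ∀ q t v w, (callGame τ D).Out q t v w → w ≤ d
  ge_d' : ∀ q t v w, (callGame τ D).Out q t v w → -d' ≤ w
  lt_K : (Nat.card (Place N B) + 1) * b < K
  lt_K' : (Nat.card (Place N B) + 1) * d < K'
  le_K' : Nat.card (Place N B) * b' + W ≤ K'
  exit_K : ∀ p x, Nat.card (Place N B) * b - K + W < sInf (exitWeights τ p x)
  call_K : ∀ p e, Nat.card (Place N B) * b - K + W < sInf (callWeights τ p e)

variable (C₀ : Set (Config N B)) (W b b' K d d' K' : ℤ)

/-- The stack below an invocation that starts at `p`, in plays of the improved strategy. -/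
inductive Chain : Place N B → Frames N B → Prop
  | base {p : Place N B} {stk : Frames N B} : Reach τ C₀ ⟨[p], stk⟩ → (∀ f ∈ stk, f.2 = []) →
      Chain p stk
  | frame {q : Place N B} {h : List (Place N B)} {stk : Frames N B} {c : B} {e : N} :
      (localGame τ M).Safe b b' (memory τ M (q :: h)) →
      (localGame τ M).Adm (memory τ M (q :: h)) q (.call c e) → e ∉ A.Ex →
      Chain (first q h) stk → Chain (.node e) ((c, q :: h) :: stk)

/-- The invariant of the plays of the improved strategy. -/
def Inv : List (Place N B) → Frames N B → Prop
  | [], _ => False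
  | q :: h, stk => (localGame τ M).Safe b b' (memory τ M (q :: h)) ∧
      Chain τ M C₀ b b' (first q h) stk

variable {τ M D C₀ W b b' K d d' K'}

theorem adm_of_legal {q : Place N B} {h : List (Place N B)} {t : Target N B}
    (hs : (localGame τ M).Safe b b' (memory τ M (q :: h)))
    (hl : Legal (improved τ M) (q :: h) t) :
    (localGame τ M).Adm (memory τ M (q :: h)) q t := by
  refine ⟨⟨hl.1, hl.2.1⟩, fun hp => ?_⟩
  have h1 : t = improvedMove τ M (q :: h).reverse.reverse := hl.2.2 hp.1
  rw [List.reverse_reverse, improvedMove, if_pos] at h1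
  · exact h1
  · obtain ⟨a, r, hr⟩ := memory_eq_cons τ M q h
    have := hs.along.self (by simp [hr])
    rw [hr] at this ⊢
    exact ((localGame τ M).win_iff.1 this).1 hp

section

variable {q : Place N B} {h : List (Place N B)}

theorem ok_of_adm (hs : (localGame τ M).Safe b b' (memory τ M (q :: h))) {t : Target N B}
    (ha : (localGame τ M).Adm (memory τ M (q :: h)) q t) :
    (∀ x ∈ A.Ex, t = .node x → Feasible (exitWeights τ (first q h) x)
      (total (memory τ M (q :: h)) + A.weight q t)) ∧
    (∀ c, ∀ e ∉ A.Ex, t = .call c e → Feasible (callWeights τ (first q h) e)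
      (total (memory τ M (q :: h)) + A.weight q t)) := by
  obtain ⟨a, r, hr⟩ := memory_eq_cons τ M q h
  have hlast := getLast?_memory τ M q h
  rw [hr] at hs ha hlast ⊢
  exact (ha.good _ (hs.along.self (by simp))).1 _ hlast

theorem Setting.safe_update [Finite N] [Finite B] (S : Setting τ M D C₀ W b b' K d d' K')
    (hs : (localGame τ M).Safe b b' (memory τ M (q :: h))) {t : Target N B}
    (ha : (localGame τ M).Adm (memory τ M (q :: h)) q t) {v : Place N B} {w : ℤ}
    (ho : LocalEdge A τ M q t v w) :
    (localGame τ M).Safe b b' (memory τ M (v :: q :: h)) ∧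
      total (memory τ M (v :: q :: h)) ≤ total (memory τ M (q :: h)) + w ∧
      heavy K (memory τ M (q :: h)) ≤ heavy K (memory τ M (v :: q :: h)) ∧
      (w ≤ -K → heavy K (memory τ M (q :: h)) + 1 ≤ heavy K (memory τ M (v :: q :: h))) := by
  rw [memory]
  obtain ⟨a, r, hr⟩ := memory_eq_cons τ M q h
  rw [hr] at hs ha ⊢
  exact hs.update _ S.b_nonneg S.le_b S.ge_b' S.lt_K ha ho

/-- By `exit_K` and `call_K` this bound is below every `sInf` of exit or call weights, so after a
heavy edge `Ok` allows only exits and calls with weights unbounded below. -/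
theorem Setting.total_le_of_heavy [Finite N] [Finite B] (S : Setting τ M D C₀ W b b' K d d' K')
    (hs : (localGame τ M).Safe b b' (memory τ M (q :: h)))
    (hh : 0 < heavy K (memory τ M (q :: h))) (t : Target N B) :
    total (memory τ M (q :: h)) + A.weight q t ≤ Nat.card (Place N B) * b - K + W := by
  have h1 := CycleGame.total_le_of_heavy S.b_nonneg hs.le (length_le_card hs.nodup) hh
  have h2 := (abs_le.1 (S.weight_le q t)).2
  linarith

/-- If the weights are bounded below, `Ok` gives the first bound and a heavy edge is impossible. If
not, `D` is at most `-K'`, which by `le_K'` is below every weight a safe memory can have. -/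
theorem Setting.callSummary_le [Finite N] [Finite B] (S : Setting τ M D C₀ W b b' K d d' K')
    (hs : (localGame τ M).Safe b b' (memory τ M (q :: h))) {c : B} {e : N}
    (ha : (localGame τ M).Adm (memory τ M (q :: h)) q (.call c e)) (he : e ∉ A.Ex) :
    D (first q h) e ≤ total (memory τ M (q :: h)) + A.weight q (.call c e) ∧
      (0 < heavy K (memory τ M (q :: h)) → D (first q h) e ≤ -K') := by
  obtain ⟨hne, hbd⟩ := (ok_of_adm hs ha).2 c e he rfl
  obtain ⟨-, h1, h2⟩ := S.callSummary _ _ hne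
  by_cases hb : BddBelow (callWeights τ (first q h) e)
  · refine ⟨(h1 hb).trans_le (hbd hb), fun hh => ?_⟩
    have h3 := S.total_le_of_heavy hs hh (.call c e)
    have h4 := S.call_K (first q h) e
    have h5 := hbd hb
    linarith
  · have h3 := le_total S.b'_nonneg hs.ge (length_le_card hs.nodup)
    have h4 := (abs_le.1 (S.weight_le q (.call c e))).1
    have h5 := S.le_K'
    exact ⟨(h2 hb).trans (by linarith), fun _ => h2 hb⟩

end

/-- `Feasible` includes that `τ` can make the same call, so the improved strategy opens no
invocation whose local game might be lost. -/
theorem Chain.starts {p : Place N B} {stk : Frames N B} (hc : Chain τ M C₀ b b' p stk) :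
    Starts τ C₀ p := by
  induction hc with
  | base hr _ => exact ⟨_, hr⟩
  | frame hs ha he _ ih => exact ih.of_callWeights ((ok_of_adm hs ha).2 _ _ he rfl).1

theorem Setting.callMemory_frame [Finite N] [Finite B] (S : Setting τ M D C₀ W b b' K d d' K')
    {q : Place N B} {h : List (Place N B)} {stk : Frames N B} {c : B} {e : N}
    (hs : (localGame τ M).Safe b b' (memory τ M (q :: h)))
    (ha : (localGame τ M).Adm (memory τ M (q :: h)) q (.call c e)) (he : e ∉ A.Ex)
    (hD : (callGame τ D).Safe d d' (callMemory τ D (first q h) stk))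
    (hc : ∃ a r, callMemory τ D (first q h) stk = (first q h, a) :: r) :
    (callGame τ D).Safe d d' (callMemory τ D (.node e) ((c, q :: h) :: stk)) ∧
      total (callMemory τ D (.node e) ((c, q :: h) :: stk)) ≤
        total (callMemory τ D (first q h) stk) + D (first q h) e ∧
      heavy K' (callMemory τ D (first q h) stk) ≤
        heavy K' (callMemory τ D (.node e) ((c, q :: h) :: stk)) ∧
      (D (first q h) e ≤ -K' → heavy K' (callMemory τ D (first q h) stk) + 1 ≤
        heavy K' (callMemory τ D (.node e) ((c, q :: h) :: stk))) := by
  rw [callMemory]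
  obtain ⟨a, r, hr⟩ := hc
  rw [hr] at hD ⊢
  exact hD.update _ S.d_nonneg S.le_d S.ge_d' S.lt_K' (t := e)
    ⟨trivial, fun h => h.elim⟩ ⟨((ok_of_adm hs ha).2 _ _ he rfl).1, rfl, rfl⟩

/-- The call memory bounds the potential of the frames from below: each `D` is at most the potential
of its frame, and the cycles removed are nonnegative. -/
theorem Setting.callMemory_spec [Finite N] [Finite B] (S : Setting τ M D C₀ W b b' K d d' K')
    {p : Place N B} {stk : Frames N B} (hc : Chain τ M C₀ b b' p stk) :
    (callGame τ D).Safe d d' (callMemory τ D p stk) ∧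
      (∃ a r, callMemory τ D p stk = (p, a) :: r) ∧
      total (callMemory τ D p stk) ≤ framesValue τ M p stk := by
  induction hc with
  | @base p stk hr hnil =>
    have h1 : callMemory τ D p stk = [(p, 0)] ∧ framesValue τ M p stk = 0 := by
      cases stk with
      | nil => exact ⟨rfl, rfl⟩
      | cons f stk =>
        obtain ⟨c, h⟩ := f
        obtain rfl : h = [] := hnil (c, h) (by simp)
        exact ⟨rfl, rfl⟩
    rw [h1.1, h1.2]
    exact ⟨(callGame τ D).safe_singleton S.d_nonneg S.d'_nonneg (S.callWin p ⟨_, hr⟩),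
      ⟨0, [], rfl⟩, by simp [total]⟩
  | @frame q h stk c e hs ha he hc ih =>
    obtain ⟨ih1, ih2, ih3⟩ := ih
    obtain ⟨h1, h2, -, -⟩ := S.callMemory_frame hs ha he ih1 ih2
    refine ⟨h1, extend_eq_cons _ _ _, h2.trans ?_⟩
    have h3 := (S.callSummary_le hs ha he).1
    show _ ≤ framesValue τ M (first q h) stk +
      (total (memory τ M (q :: h)) + A.weight q (.call c e))
    linarith

theorem Setting.le_value [Finite N] [Finite B] (S : Setting τ M D C₀ W b b' K d d' K')
    {h : List (Place N B)} {stk : Frames N B} (hi : Inv τ M C₀ b b' h stk) :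
    -(Nat.card (Place N B) * d' + Nat.card (Place N B) * b') ≤ value τ M h stk := by
  cases h with
  | nil => exact hi.elim
  | cons q h =>
    obtain ⟨hs, hc⟩ := hi
    obtain ⟨h1, -, h2⟩ := S.callMemory_spec hc
    have h3 := le_total S.b'_nonneg hs.ge (length_le_card hs.nodup)
    have h4 := le_total S.d'_nonneg h1.ge (length_le_card h1.nodup)
    rw [value]
    linarith

theorem heavy_le_card {V : Type*} [Finite V] (K : ℤ) {r : List (V × ℤ)}
    (hr : (r.map Prod.fst).Nodup) : heavy K r ≤ Nat.card V :=
  List.countP_le_length.trans (length_le_card hr)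

theorem Setting.rank_le [Finite N] [Finite B] (S : Setting τ M D C₀ W b b' K d d' K')
    {h : List (Place N B)} {stk : Frames N B} (hi : Inv τ M C₀ b b' h stk) :
    rank τ M D K K' h stk ≤
      Nat.card (Place N B) * (Nat.card (Place N B) + 1) + Nat.card (Place N B) := by
  cases h with
  | nil => exact hi.elim
  | cons q h =>
    obtain ⟨hs, hc⟩ := hi
    obtain ⟨h1, -, -⟩ := S.callMemory_spec hc
    rw [rank]
    gcongr
    · exact heavy_le_card _ h1.nodup
    · exact heavy_le_card _ hs.nodup

theorem Setting.inv_base [Finite N] [Finite B] (S : Setting τ M D C₀ W b b' K d d' K')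
    {p : Place N B} {stk : Frames N B} (hr : Reach τ C₀ ⟨[p], stk⟩) (hnil : ∀ f ∈ stk, f.2 = []) :
    Inv τ M C₀ b b' [p] stk :=
  ⟨(localGame τ M).safe_singleton S.b_nonneg S.b'_nonneg (S.win p ⟨_, hr⟩), .base hr hnil⟩

theorem Setting.inv_internal [Finite N] [Finite B] (S : Setting τ M D C₀ W b b' K d d' K')
    {q v : Place N B} {h : List (Place N B)} {stk : Frames N B} {t : Target N B}
    (hi : Inv τ M C₀ b b' (q :: h) stk)
    (ha : (localGame τ M).Adm (memory τ M (q :: h)) q t)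
    (ho : LocalEdge A τ M q t v (A.weight q t)) :
    Inv τ M C₀ b b' (v :: q :: h) stk ∧
      Change (value τ M) (fun h => heavy K (memory τ M h)) (rank τ M D K K')
        ⟨q :: h, stk⟩ (A.weight q t) ⟨v :: q :: h, stk⟩ := by
  obtain ⟨hs, hc⟩ := hi
  obtain ⟨h1, h2, h3, -⟩ := S.safe_update hs ha ho
  refine ⟨⟨h1, by rwa [first_cons]⟩, .internal ?_ h3 ?_⟩
  · rw [value, value, first_cons]
    linarith
  · rw [rank, rank, first_cons]
    gcongr

theorem Setting.inv_call [Finite N] [Finite B] (S : Setting τ M D C₀ W b b' K d d' K')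
    {q : Place N B} {h : List (Place N B)} {stk : Frames N B} {c : B} {e : N}
    (hi : Inv τ M C₀ b b' (q :: h) stk)
    (ha : (localGame τ M).Adm (memory τ M (q :: h)) q (.call c e)) (he : e ∉ A.Ex) :
    Inv τ M C₀ b b' [.node e] ((c, q :: h) :: stk) ∧
      Change (value τ M) (fun h => heavy K (memory τ M h)) (rank τ M D K K')
        ⟨q :: h, stk⟩ (A.weight q (.call c e)) ⟨[.node e], (c, q :: h) :: stk⟩ := by
  obtain ⟨hs, hc⟩ := hi
  have hc' : Chain τ M C₀ b b' (.node e) ((c, q :: h) :: stk) := .frame hs ha he hc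
  refine ⟨⟨(localGame τ M).safe_singleton S.b_nonneg S.b'_nonneg (S.win _ hc'.starts), hc'⟩,
    .call ?_ ?_⟩
  · show framesValue τ M (first q h) stk + (total (memory τ M (q :: h)) +
      A.weight q (.call c e)) + total [((.node e : Place N B), (0 : ℤ))] ≤ _
    have h0 : total [((.node e : Place N B), (0 : ℤ))] = 0 := by simp [total]
    rw [value]
    linarith
  · obtain ⟨hD, hcons, -⟩ := S.callMemory_spec hc
    obtain ⟨-, -, h3, h4⟩ := S.callMemory_frame hs ha he hD hcons
    show _ ≤ heavy K' (callMemory τ D (.node e) ((c, q :: h) :: stk)) * _ + heavy K _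
    rw [rank]
    refine le_trans ?_ (Nat.le_add_right _ _)
    -- The caller's local count is dropped. It is at most the number of places, and a positive count
    -- forces a heavy call edge, worth one more than that in `rank`.
    by_cases hh : 0 < heavy K (memory τ M (q :: h))
    · have h5 := h4 ((S.callSummary_le hs ha he).2 hh)
      have h6 := heavy_le_card K hs.nodup
      calc _ ≤ (heavy K' (callMemory τ D (first q h) stk) + 1) * (Nat.card (Place N B) + 1) := by
            rw [add_mul]; omega
        _ ≤ _ := by gcongr
    · rw [Nat.eq_zero_of_not_pos hh, add_zero]
      gcongr

/-- With exit weights bounded below, the real weight is at least the summary and the potential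
behaves. Otherwise the caller records a heavy edge, which is the exception allowed by `Change.ret`.
-/
theorem Setting.inv_exit [Finite N] [Finite B] (S : Setting τ M D C₀ W b b' K d d' K')
    {q : Place N B} {h h' : List (Place N B)} {stk : Frames N B} {c : B} {x : N}
    (hi : Inv τ M C₀ b b' (q :: h) ((c, h') :: stk))
    (ha : (localGame τ M).Adm (memory τ M (q :: h)) q (.node x)) (hx : x ∈ A.Ex) :
    Inv τ M C₀ b b' (.ret c x :: h') stk ∧
      Change (value τ M) (fun h => heavy K (memory τ M h)) (rank τ M D K K')
        ⟨q :: h, (c, h') :: stk⟩ (A.weight q (.node x)) ⟨.ret c x :: h', stk⟩ := by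
  obtain ⟨hs, hc⟩ := hi
  obtain ⟨hne, hbd⟩ := (ok_of_adm hs ha).1 x hx rfl
  generalize hp : first q h = p at hc hne hbd
  cases hc with
  -- This is a return into a box of the initial stack. A run of `τ` to the same exit shows that the
  -- new start is reachable under `τ`.
  | base hr hnil =>
    obtain rfl : h' = [] := hnil (c, h') (by simp)
    obtain ⟨w, k, hrun⟩ := hne
    exact ⟨S.inv_base (hr.trans (hrun.seg _ _ _)) fun f hf => hnil f (by simp [hf]), .bottom⟩
  | @frame q' h'' _ _ e hs' ha' he hc =>
    obtain ⟨h1, h2, h3, h4⟩ := S.safe_update hs' ha' (.call he hne)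
    obtain ⟨-, hM1, hM2⟩ := S.summary _ _ hne
    -- The summary is at most `-(K + W)`, so the edge stays at most `-K` after the weight of the
    -- call is added.
    have hheavy : ¬ BddBelow (exitWeights τ (.node e) x) →
        0 < heavy K (memory τ M (.ret c x :: q' :: h'')) ∧
        rank τ M D K K' (q' :: h'') stk < rank τ M D K K' (.ret c x :: q' :: h'') stk := by
      intro hb
      have h5 := (abs_le.1 (S.weight_le q' (.call c e))).2
      have h6 := h4 (by have := hM2 hb; linarith)
      refine ⟨by omega, ?_⟩
      rw [rank, rank, first_cons]
      omega
    refine ⟨⟨h1, by rwa [first_cons]⟩, .ret h3 ?_ ?_ ?_⟩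
    · rw [rank, rank, first_cons]
      gcongr
    · by_cases hb : BddBelow (exitWeights τ (.node e) x)
      · left
        rw [value, value, first_cons, hp]
        show _ ≤ framesValue τ M (first q' h'') stk + (total (memory τ M (q' :: h'')) +
          A.weight q' (.call c e)) + _ + _
        have h5 := hM1 hb
        have h6 := hbd hb
        linarith
      · exact .inr (hheavy hb)
    · intro hh
      refine hheavy fun hb => ?_
      have h5 := S.total_le_of_heavy hs hh (.node x)
      have h6 := S.exit_K (.node e) x
      have h7 := hbd hb
      linarith

theorem Setting.inv_step [Finite N] [Finite B] (S : Setting τ M D C₀ W b b' K d d' K')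
    {s : HState N B} {t t' : Target N B} (hi : Inv τ M C₀ b b' s.hist s.stk)
    (hl : Legal (improved τ M) s.hist t) (hl' : Legal (improved τ M) (A.step s t).hist t') :
    Inv τ M C₀ b b' (A.step s t).hist (A.step s t).stk ∧
      Change (value τ M) (fun h => heavy K (memory τ M h)) (rank τ M D K K')
        s (A.histWeight s.hist t) (A.step s t) := by
  obtain ⟨_ | ⟨q, h⟩, stk⟩ := s
  · exact hl.elim
  have ha := adm_of_legal hi.1 hl
  cases t with
  | node v =>
    by_cases hv : v ∈ A.Ex
    · cases stk with
      -- An exit with empty stack has no legal continuation, contrary to `hl'`.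
      | nil =>
        rw [step_exit_nil hv] at hl'
        exact absurd hv hl'.1
      | cons f stk =>
        obtain ⟨c, h'⟩ := f
        rw [step_exit hv]
        exact S.inv_exit hi ha hv
    · rw [step_node hv]
      exact S.inv_internal hi ha (.node hv)
  | call c e =>
    by_cases he : e ∈ A.Ex
    · rw [step_call_exit he]
      exact S.inv_internal hi ha (.pass he)
    · rw [step_call he]
      exact S.inv_call hi ha he

theorem Setting.winsLimInf [Finite N] [Finite B] (S : Setting τ M D C₀ W b b' K d d' K') :
    (improved τ M).WinsLimInf C₀ := by
  intro π hπ hcons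
  have hl := π.legal hcons
  have hinv : ∀ k, Inv τ M C₀ b b' (A.states (π.conf 0) π.move k).hist
      (A.states (π.conf 0) π.move k).stk := by
    intro k
    induction k with
    | zero =>
      refine S.inv_base ⟨_, hπ, 0, 0, .refl _⟩ fun f hf => ?_
      obtain ⟨c, -, rfl⟩ := List.mem_map.1 hf
      rfl
    | succ k ih => exact (S.inv_step ih (hl k).1 (hl (k + 1)).1).1
  obtain ⟨C, hC⟩ := Change.exists_le_sum
    (fun k => (S.inv_step (hinv k) (hl k).1 (hl (k + 1)).1).2)
    (fun k => S.le_value (hinv k)) (fun k => S.rank_le (hinv k))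
  refine Play.limInfAvg_nonneg (C := C) fun k => (hC k).trans_eq ?_
  exact Finset.sum_congr rfl fun j _ => (hl j).2

end Improved

/-! ### Choice of the constants, and the theorem. -/

theorem exists_setting [Finite N] [Finite B] {τ : A.ModularStrategy} {C₀ : Set (Config N B)}
    (hτ : τ.WinsLimSup C₀) :
    ∃ M D W b b' K d d' K', Setting τ M D C₀ W b b' K d d' K' := by
  obtain ⟨W, hW0, hW⟩ := A.exists_abs_weight_le
  obtain ⟨m, hm0, hm⟩ := exists_abs_le fun p x => sInf (exitWeights τ p x)
  obtain ⟨d, hd0, hd⟩ := exists_abs_le fun p e => sInf (callWeights τ p e)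
  obtain ⟨c, hc⟩ : ∃ c : ℤ, ((Nat.card (Place N B) : ℕ) : ℤ) = c := ⟨_, rfl⟩
  have hc0 : 0 ≤ c := hc ▸ by positivity
  have hcb : 0 ≤ c * (W + m) := by positivity
  -- There is no circularity: the upper bounds `W + m` and `d` for the edges come from the infima
  -- alone (`sInf` is 0 on sets unbounded below), so they precede the thresholds and summaries.
  set K : ℤ := (c + 1) * (W + m) + W + m + d + 1 with hK
  obtain ⟨M, hM⟩ := exists_isSummary (K + W) (exitWeights τ)
  obtain ⟨m', hm'0, hm'⟩ := exists_abs_le M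
  -- The lower bound for the local edges depends on `M`, hence on `K`; so `K'` is fixed only now,
  -- and `D` after it.
  set K' : ℤ := (c + 1) * d + c * (W + m') + W + 1 with hK'
  have hcm' : 0 ≤ c * (W + m') := by positivity
  have hcd : 0 ≤ c * d := by positivity
  obtain ⟨D, hD⟩ := exists_isSummary K' (callWeights τ)
  obtain ⟨d', hd'0, hd'⟩ := exists_abs_le D
  have hMm : ∀ p x, (exitWeights τ p x).Nonempty → M p x ≤ m := by
    intro p x hne
    obtain ⟨-, h1, h2⟩ := hM p x hne
    by_cases hb : BddBelow (exitWeights τ p x)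
    · rw [h1 hb]; exact (abs_le.1 (hm p x)).2
    · have := h2 hb
      linarith
  have hDd : ∀ p x, (callWeights τ p x).Nonempty → D p x ≤ d := by
    intro p x hne
    obtain ⟨-, h1, h2⟩ := hD p x hne
    by_cases hb : BddBelow (callWeights τ p x)
    · rw [h1 hb]; exact (abs_le.1 (hd p x)).2
    · have := h2 hb
      linarith
  refine ⟨M, D, W, W + m, W + m', K, d, d', K', hW, hM, hD, fun p hp => win_localGame hτ hM hp,
    fun p hp => win_callGame hτ hD hp, by linarith, by linarith, hd0, hd'0, ?_, ?_, ?_, ?_,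
    by rw [hc]; linarith, by rw [hc]; linarith, by rw [hc]; linarith, fun p x => ?_,
    fun p e => ?_⟩
  · rintro q t v w (hv | he | ⟨he, hne⟩)
    · exact ((abs_le.1 (hW _ _)).2).trans (by linarith)
    · exact ((abs_le.1 (hW _ _)).2).trans (by linarith)
    · exact add_le_add (abs_le.1 (hW _ _)).2 (hMm _ _ hne)
  · rintro q t v w (hv | he | ⟨he, hne⟩)
    · exact le_trans (by linarith) (abs_le.1 (hW _ _)).1
    · exact le_trans (by linarith) (abs_le.1 (hW _ _)).1
    · rw [neg_add]
      exact add_le_add (abs_le.1 (hW _ _)).1 (abs_le.1 (hm' _ _)).1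
  · rintro q t v w ⟨hne, -, rfl⟩
    exact hDd _ _ hne
  · rintro q t v w ⟨-, -, rfl⟩
    exact (abs_le.1 (hd' _ _)).1
  · have := (abs_le.1 (hm p x)).1
    rw [hc]
    linarith
  · have := (abs_le.1 (hd p e)).1
    rw [hc]
    linarith

end WRG

theorem mainTheorem9 {n : ℕ} {N B : Type*} [Finite N] [Finite B] (A : WRG n N B)
    (C₀ : Set (Config N B)) :
    (∃ τ : A.ModularStrategy, τ.WinsLimSup C₀) ↔ (∃ τ : A.ModularStrategy, τ.WinsLimInf C₀) := by
  constructor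
  · rintro ⟨τ, hτ⟩
    -- The improved strategy uses a default target, hence a node; without nodes there are no plays.
    cases isEmpty_or_nonempty N with
    | inl h => exact ⟨τ, fun π => (h.false (π.conf 0).node).elim⟩
    | inr h =>
      obtain ⟨M, D, W, b, b', K, d, d', K', S⟩ := WRG.exists_setting hτ
      exact ⟨_, S.winsLimInf⟩
  · rintro ⟨τ, hτ⟩
    exact ⟨τ, fun π h hc => (hτ π h hc).trans π.limInfAvg_le_limSupAvg⟩
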